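/- Let $A$ be an ordered Banach algebra: a complex Banach algebra with unit $\mathbf e\neq 0$ and a closed convex cone $A^+$ with $A^+\cap(-A^+)=\{0\}$, $\mathbf e\in A^+$ and $A^+\cdot A^+\subseteq A^+$, ordered by $x\le y\iff y-x\in A^+$. Let $\mathbf{OI}(A)=\{p\in A: 0\le p\le\mathbf e,\ p^2=p\}$ be the set of order idempotents, with the induced order (a Boolean algebra), and write $p^{\rm d}=\mathbf e-p$. An element $a\in A^+$ is *order continuous* ($a\in A_{\rm n}$) if $p_\alpha a\downarrow 0$ and $ap_\alpha\downarrow0$ in $A$ for every net $p_\alpha\downarrow0$ in $\mathbf{OI}(A)$; $a\in A^+$ is *irreducible* if $p\in\mathbf{OI}(A)$ and $p^{\rm d}ap=0$ imply $p\in\{0,\mathbf e\}$; and $b\in A$ is *algebraically strictly positive*, $b\gg0$, if $pbq>0$ for all non-zero $p,q\in\mathbf{OI}(A)$. Put $A_{\rm r}=A^+-A^+$ and, for $b\in A^+$, let $A_b=\{y\in A:-tb\le y\le tb\text{ for some real }t\ge0\}$ be the real order ideal generated by $b$. Let $r(a)$ be the spectral radius, $\sigma_{\rm per}(a)=\{\lambda\in\sigma(a):|\lambda|=r(a)\}$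 the peripheral spectrum and $R(\lambda,a)=(\lambda-a)^{-1}$ the resolvent. A point $\lambda_0$ is a pole of $R(\cdot,a)$ if it is an isolated point of $\sigma(a)$ and the Laurent expansion of $R(\cdot,a)$ around $\lambda_0$ has a non-zero coefficient of index $-k$ and vanishing coefficients of index $<-k$ for some integer $k\ge1$. If $r(a)$ is an isolated point of $\sigma(a)$, let $a_{-1}$ be the residue (the coefficient of index $-1$) of $R(\cdot,a)$ at $r(a)$. Assume that $A$ satisfies the following axioms. - $(A_1)$ $A_{\rm n}$ is closed under multiplication; whenever $a,b\in A_{\rm n}$ and $ab=0$ there is $p\in\mathbf{OI}(A)$ with $ap=p^{\rm d}b=0$; the Boolean algebra $\mathbf{OI}(A)$ is Dedekind complete; and $A_{\rm n}$ is closed in $A$. - $(A_2)$ Every idempotent $b\gg0$ of $A$ is minimal, that is, $bAb=\mathbb Cb$. - $(A_3)$ For every non-zero $b\in A^+$ there is a lattice isomorphism of $A_b$ onto a space $C(K)$ of real continuous functions on a compact Hausdorff space $K$, mapping $b$ to the constant function $1$. - $(A_4)$ If $a,b\in A_{\rm r}$ and $a+ib=0$, then $a=b=0$. - $(A_5)$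 If $(b_n)$ and $(c_n)$ are sequences in $A_{\rm r}$ and $(b_n+ic_n)$ converges, then $(b_n)$ and $(c_n)$ converge. - $(A_{\rm LS}')$ If $a\in A^+$, $r(a)$ is a pole of $R(\cdot,a)$, $a_{-1}$ is order continuous and $a_{-1}\gg0$, then every point of $\sigma_{\rm per}(a)$ is a pole of $R(\cdot,a)$. Let $a\in A$ be non-zero, order continuous and irreducible, and let $r(a)$ be a pole of $R(\cdot,a)$. Then every point of $\sigma_{\rm per}(a)$ is a pole of $R(\cdot,a)$, and $\sigma_{\rm per}(a)=r(a)H_m$ for some integer $m\ge1$, where $H_m$ is the group of all $m$-th roots of unity. -/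

import Mathlib

open Filter Topology Set

/-!
An ordered Banach algebra is a complex Banach algebra `A` with unit `1 ≠ 0` and a closed convex
cone defining a partial order, such that `0 ≤ 1` and products of positive elements are positive.
In Mathlib's terms: `[NormedRing A] [NormedAlgebra ℂ A] [CompleteSpace A] [Nontrivial A]`
together with `[PartialOrder A] [IsOrderedRing A] [PosSMulMono ℝ A] [OrderClosedTopology A]`.
-/

namespace OrdBanachAlg

universe u

section Spectral

variable {A : Type u} [NormedRing A] [NormedAlgebra ℂ A]

/-- The spectral radius `r(a)`, as a real number. -/
noncomputable def specRadius (a : A) : ℝ := (spectralRadius ℂ a).toReal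

/-- The peripheral spectrum: the points of the spectrum of modulus `r(a)`. -/
def peripheralSpectrum (a : A) : Set ℂ := {z | z ∈ spectrum ℂ a ∧ ‖z‖ = specRadius a}

/-- `z₀` is an isolated point of the spectrum of `a`. -/
def IsIsolatedSpectralPoint (a : A) (z₀ : ℂ) : Prop :=
  z₀ ∈ spectrum ℂ a ∧ ∀ᶠ z in 𝓝[≠] z₀, z ∉ spectrum ℂ a

/-- `c j`, `j ∈ ℤ`, are the coefficients of the Laurent expansion of the resolvent
`R(z, a) = (z - a)⁻¹` in a punctured neighbourhood of `z₀`. -/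
def IsLaurentExpansion (a : A) (z₀ : ℂ) (c : ℤ → A) : Prop :=
  ∀ᶠ z in 𝓝[≠] z₀, HasSum (fun j : ℤ => (z - z₀) ^ j • c j) (resolvent a z)

/-- `z₀` is a pole of order `k ≥ 1` of the resolvent `R(·, a)`. -/
def IsPoleOfOrder (a : A) (z₀ : ℂ) (k : ℕ) : Prop :=
  1 ≤ k ∧ IsIsolatedSpectralPoint a z₀ ∧
    ∃ c : ℤ → A, IsLaurentExpansion a z₀ c ∧ (∀ j : ℤ, j < -(k : ℤ) → c j = 0) ∧ c (-(k : ℤ)) ≠ 0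

/-- `z₀` is a pole of the resolvent `R(·, a)`. -/
def IsPole (a : A) (z₀ : ℂ) : Prop := ∃ k : ℕ, IsPoleOfOrder a z₀ k

/-- `b` is the residue of the resolvent `R(·, a)` at `z₀`. -/
def IsResidue (a : A) (z₀ : ℂ) (b : A) : Prop :=
  ∃ c : ℤ → A, IsLaurentExpansion a z₀ c ∧ c (-1) = b

/-- A minimal idempotent: `b ≠ 0`, `b² = b` and `bAb = ℂb`. -/
def IsMinimalIdempotent (b : A) : Prop :=
  IsIdempotentElem b ∧ b ≠ 0 ∧ range (fun x : A => b * x * b) = range (fun μ : ℂ => μ • b)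

end Spectral

/-- The group `H_m` of all `m`-th roots of unity, as a set of complex numbers. -/
def rootsOfUnitySet (m : ℕ) : Set ℂ := {z | z ^ m = 1}

/-- `x_α ↓ x`: the net decreases and has infimum `x` in the ordered set `P`. -/
def DecreasesTo {ι : Type*} {P : Type*} [Preorder ι] [Preorder P] (x : ι → P) (x₀ : P) : Prop :=
  Antitone x ∧ IsGLB (range x) x₀

section Order

variable (A : Type u) [NormedRing A] [NormedAlgebra ℂ A] [PartialOrder A]

/-- The set `OI(A)` of order idempotents, with the order induced by `A`. -/
def OI : Type u := {p : A // 0 ≤ p ∧ p ≤ 1 ∧ p * p = p}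

instance : PartialOrder (OI A) := inferInstanceAs (PartialOrder {p : A // 0 ≤ p ∧ p ≤ 1 ∧ p * p = p})

instance : CoeOut (OI A) A := ⟨Subtype.val⟩

instance [IsOrderedRing A] : Zero (OI A) := ⟨⟨0, le_refl _, zero_le_one, by simp⟩⟩

instance [IsOrderedRing A] : One (OI A) := ⟨⟨1, zero_le_one, le_refl _, by simp⟩⟩

/-- The Boolean algebra `OI(A)` is Dedekind complete. -/
def OIDedekindComplete : Prop :=
  ∀ S : Set (OI A), S.Nonempty → BddAbove S → ∃ s : OI A, IsLUB S s

variable {A}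

/-- Order continuous elements: positive `a` such that `p_α ↓ 0` in `OI(A)` implies `p_α a ↓ 0`
and `a p_α ↓ 0` in `A`. Nothing changes if nets are indexed by directed sets of other universes,
since only the range of a decreasing net matters. -/
def IsOrderContinuous [IsOrderedRing A] (a : A) : Prop :=
  0 ≤ a ∧ ∀ (ι : Type u) [Preorder ι] [IsDirectedOrder ι] [Nonempty ι] (p : ι → OI A),
    DecreasesTo p 0 →
      DecreasesTo (fun α => (p α : A) * a) 0 ∧ DecreasesTo (fun α => a * (p α : A)) 0

/-- Irreducible elements: positive, without non-trivial invariant order idempotents. -/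
def IsIrreducible (a : A) : Prop :=
  0 ≤ a ∧ ∀ p : OI A, (1 - (p : A)) * a * (p : A) = 0 → (p : A) = 0 ∨ (p : A) = 1

/-- Algebraically strictly positive elements, `a ≫ 0`. -/
def IsAlgStrictlyPos (a : A) : Prop :=
  ∀ p q : OI A, 0 < (p : A) → 0 < (q : A) → 0 < (p : A) * a * (q : A)

variable (A)

/-- The order continuous elements are closed under multiplication. -/
def IsOrderRegular [IsOrderedRing A] : Prop :=
  ∀ a b : A, IsOrderContinuous a → IsOrderContinuous b → IsOrderContinuous (a * b)

/-- `A` has a disjunctive product. -/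
def HasDisjunctiveProduct [IsOrderedRing A] : Prop :=
  ∀ a b : A, IsOrderContinuous a → IsOrderContinuous b → a * b = 0 →
    ∃ p : OI A, a * (p : A) = 0 ∧ (1 - (p : A)) * b = 0

variable {A}

/-- The order ideal `A_b = {y | -t b ≤ y ≤ t b for some t ≥ 0}`, a real linear subspace. -/
def orderIdeal [IsOrderedRing A] [PosSMulMono ℝ A] (b : A) : Submodule ℝ A where
  carrier := {y | ∃ t : ℝ, 0 ≤ t ∧ -(t • b) ≤ y ∧ y ≤ t • b}
  zero_mem' := ⟨0, le_refl _, by simp, by simp⟩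
  add_mem' := by
    rintro x y ⟨s, hs, hx1, hx2⟩ ⟨t, ht, hy1, hy2⟩
    refine ⟨s + t, add_nonneg hs ht, ?_, ?_⟩
    · have := add_le_add hx1 hy1
      rwa [← neg_add, ← add_smul] at this
    · have := add_le_add hx2 hy2
      rwa [← add_smul] at this
  smul_mem' := by
    rintro c x ⟨s, hs, hx1, hx2⟩
    rcases le_total 0 c with hc | hc
    · refine ⟨c * s, mul_nonneg hc hs, ?_, ?_⟩
      · have := smul_le_smul_of_nonneg_left hx1 hc
        rwa [smul_neg, smul_smul] at this
      · have := smul_le_smul_of_nonneg_left hx2 hc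
        rwa [smul_smul] at this
    · have hc' : 0 ≤ -c := neg_nonneg.mpr hc
      refine ⟨-c * s, mul_nonneg hc' hs, ?_, ?_⟩
      · have := neg_le_neg (smul_le_smul_of_nonneg_left hx2 hc')
        rwa [smul_smul, neg_smul c x, neg_neg] at this
      · have := neg_le_neg (smul_le_smul_of_nonneg_left hx1 hc')
        rwa [smul_neg, neg_neg, smul_smul, neg_smul c x, neg_neg] at this

lemma self_mem_orderIdeal [IsOrderedRing A] [PosSMulMono ℝ A] {b : A} (hb : 0 ≤ b) :
    b ∈ orderIdeal b :=
  ⟨1, zero_le_one, by simpa using (neg_nonpos.mpr hb).trans hb, by simp⟩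

variable (A)

/-- The set `A_r = A⁺ - A⁺` of regular elements. -/
def regularElements : Set A := {x | ∃ y z : A, 0 ≤ y ∧ 0 ≤ z ∧ x = y - z}

/-- Axiom (A₁). -/
structure AxiomA1 [IsOrderedRing A] : Prop where
  orderRegular : IsOrderRegular A
  disjunctiveProduct : HasDisjunctiveProduct A
  dedekindComplete : OIDedekindComplete A
  isClosed : IsClosed {a : A | IsOrderContinuous a}

/-- Axiom (A₂): every algebraically strictly positive idempotent is minimal. -/
def AxiomA2 : Prop :=
  ∀ b : A, IsIdempotentElem b → IsAlgStrictlyPos b → IsMinimalIdempotent b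

/-- Axiom (A₃): for `0 ≠ b ≥ 0` there is a linear order isomorphism (equivalently, a lattice
isomorphism) of the order ideal `A_b` onto a space `C(K)` of real continuous functions on a
compact Hausdorff space, mapping `b` to the constant function one. -/
def AxiomA3 [IsOrderedRing A] [PosSMulMono ℝ A] : Prop :=
  ∀ (b : A) (hb : 0 ≤ b), b ≠ 0 →
    ∃ (K : Type u) (_ : TopologicalSpace K) (_ : CompactSpace K) (_ : T2Space K)
      (e : orderIdeal b ≃ₗ[ℝ] C(K, ℝ)),
      (∀ x y : orderIdeal b, e x ≤ e y ↔ (x : A) ≤ (y : A)) ∧ e ⟨b, self_mem_orderIdeal hb⟩ = 1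

/-- Axiom (A₄). -/
def AxiomA4 : Prop :=
  ∀ a ∈ regularElements A, ∀ b ∈ regularElements A, a + Complex.I • b = 0 → a = 0 ∧ b = 0

/-- Axiom (A₅). -/
def AxiomA5 : Prop :=
  ∀ b c : ℕ → A, (∀ n, b n ∈ regularElements A) → (∀ n, c n ∈ regularElements A) →
    (∃ l : A, Tendsto (fun n => b n + Complex.I • c n) atTop (𝓝 l)) →
      (∃ l : A, Tendsto b atTop (𝓝 l)) ∧ ∃ l : A, Tendsto c atTop (𝓝 l)

/-- The weak Lotz-Schaefer axiom. -/
def AxiomLS' [IsOrderedRing A] : Prop :=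
  ∀ a : A, 0 ≤ a → IsPole a (specRadius a : ℂ) →
    ∀ a₁ : A, IsResidue a (specRadius a : ℂ) a₁ → IsOrderContinuous a₁ → IsAlgStrictlyPos a₁ →
      ∀ z ∈ peripheralSpectrum a, IsPole a z

end Order

end OrdBanachAlg

/-!
If `r(a) = 0`, the peripheral spectrum is `{0}`. Let `r = r(a) > 0`.

*The pole at `r`.* For `t > r` the element `s = R(t, a) a = ∑ aⁿ⁺¹ / tⁿ⁺¹` is order continuous and
dominates both `a` and `s a` up to the factor `t`. If `p s q = 0` with order idempotents `p`, `q`,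
the largest order idempotent `u` with `p s u = 0` is invariant under `a`, by the disjunctive product
applied to `(p s)(a u) = 0`. Hence `s ≫ 0` by irreducibility
(`IsIrreducible.isAlgStrictlyPos`). The leading Laurent coefficient `b` at `r` is a limit of
multiples of order continuous elements, and `s` scales it, so `b ≫ 0`. If the pole had order
greater than one, then `b * b = 0`, against `b ≫ 0`. So the pole is simple and its residue `b` is a
strictly positive order continuous idempotent with `a b = b a = r b`
(`exists_perron_projection`). The weak Lotz-Schaefer axiom now makes every peripheral point a pole,
and by compactness there are only finitely many.

*Eigenvectors.* Approach a peripheral pole `r ζ` radially. The resolvent there splits into two real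
series dominated by `R(t, a)`, so by axiom (A₅) the leading coefficient is, up to a unimodular
factor, `h = f + i g` with `-b ≤ f, g ≤ b` and `a h = h a = r ζ h`
(`exists_peripheral_eigenvector`). Thus `h` lives in the complexification of `A_b = C(K)`, on which
left and right multiplication by `a / r` are positive operators fixing the unit `b = 1`. The modulus
`m = |h|` satisfies `r m ≤ a m` and `r m ≤ m a`; because `b ≫ 0` annihilates the differences, these
are equalities. So `m = b m b` is a multiple of `b` by the minimality of `b`, that is, `h` has
constant modulus.

*The group.* If a Markov operator on `C(K)` has an eigenvector `h` of modulus one to a unimodular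
eigenvalue, then each of the functionals `f ↦ (T f)(x)` is multiplicative at `h`, by the equality
case of the Cauchy-Schwarz inequality (`map_mul_of_unimodular`). So the products `h * conj h'` of
eigenvectors are eigenvectors to `ζ * conj η` (`IsEigenpair.mul_conj`), and the unimodular numbers
`ζ` with `r ζ ∈ σ(a)` form a finite group, which consists of all `m`-th roots of unity for its
order `m`.
-/

open Filter Topology Set

namespace OrdBanachAlg

/-! ### Decreasing nets -/

lemma DecreasesTo.of_le {ι P : Type*} [Preorder ι] [Preorder P] {x y : ι → P} {l : P}
    (hy : DecreasesTo y l) (hx : Antitone x) (hl : ∀ i, l ≤ x i) (hxy : ∀ i, x i ≤ y i) :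
    DecreasesTo x l := by
  refine ⟨hx, ?_, fun z hz => hy.2.2 ?_⟩
  · rintro _ ⟨i, rfl⟩
    exact hl i
  · rintro _ ⟨i, rfl⟩
    exact (hz ⟨i, rfl⟩).trans (hxy i)

lemma DecreasesTo.add_zero {ι P : Type*} [Preorder ι] [IsDirectedOrder ι] [AddCommGroup P]
    [PartialOrder P] [IsOrderedAddMonoid P] {x y : ι → P}
    (hx : DecreasesTo x 0) (hy : DecreasesTo y 0) :
    DecreasesTo (fun i => x i + y i) 0 := by
  refine ⟨hx.1.add hy.1, ?_, fun z hz => ?_⟩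
  · rintro _ ⟨i, rfl⟩
    exact add_nonneg (hx.2.1 ⟨i, rfl⟩) (hy.2.1 ⟨i, rfl⟩)
  · refine hy.2.2 ?_
    rintro _ ⟨j, rfl⟩
    refine sub_nonpos.1 (hx.2.2 ?_)
    rintro _ ⟨i, rfl⟩
    obtain ⟨k, hik, hjk⟩ := exists_ge_ge i j
    have h : z ≤ x k + y k := hz ⟨k, rfl⟩
    exact sub_le_iff_le_add.2 (h.trans (add_le_add (hx.1 hik) (hy.1 hjk)))

/-! ### Order idempotents and order continuous elements -/

section OrderIdempotents

variable {A : Type*} [NormedRing A] [PartialOrder A]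

lemma OI.nonneg (p : OI A) : 0 ≤ (p : A) := p.2.1

lemma OI.le_one (p : OI A) : (p : A) ≤ 1 := p.2.2.1

lemma OI.mul_self (p : OI A) : (p : A) * p = p := p.2.2.2

lemma OI.pos_of_ne_zero {p : OI A} (h : (p : A) ≠ 0) : 0 < (p : A) := lt_of_le_of_ne p.nonneg h.symm

end OrderIdempotents

section OrderContinuity

variable {A : Type*} [NormedRing A] [PartialOrder A] [IsOrderedRing A]

lemma IsOrderContinuous.nonneg {a : A} (ha : IsOrderContinuous a) : 0 ≤ a := ha.1

lemma IsOrderContinuous.zero : IsOrderContinuous (0 : A) := by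
  refine ⟨le_rfl, fun ι _ _ _ p hp => ?_⟩
  have h : DecreasesTo (fun _ : ι => (0 : A)) 0 := by
    refine ⟨fun _ _ _ => le_rfl, ?_⟩
    rw [range_const]
    exact isGLB_singleton
  simp only [mul_zero, zero_mul]
  exact ⟨h, h⟩

lemma IsOrderContinuous.of_le {a b : A} (hb : IsOrderContinuous b) (ha : 0 ≤ a) (hab : a ≤ b) :
    IsOrderContinuous a := by
  refine ⟨ha, fun ι _ _ _ p hp => ?_⟩
  obtain ⟨h1, h2⟩ := hb.2 ι p hp
  refine ⟨h1.of_le (fun i j hij => ?_) (fun i => mul_nonneg (p i).nonneg ha)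
    (fun i => mul_le_mul_of_nonneg_left hab (p i).nonneg),
    h2.of_le (fun i j hij => ?_) (fun i => mul_nonneg ha (p i).nonneg)
    (fun i => mul_le_mul_of_nonneg_right hab (p i).nonneg)⟩
  · exact mul_le_mul_of_nonneg_right (hp.1 hij) ha
  · exact mul_le_mul_of_nonneg_left (hp.1 hij) ha

lemma IsOrderContinuous.add {a b : A} (ha : IsOrderContinuous a) (hb : IsOrderContinuous b) :
    IsOrderContinuous (a + b) := by
  refine ⟨add_nonneg ha.1 hb.1, fun ι _ _ _ p hp => ?_⟩
  obtain ⟨h1, h2⟩ := ha.2 ι p hp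
  obtain ⟨h3, h4⟩ := hb.2 ι p hp
  simp only [mul_add, add_mul]
  exact ⟨h1.add_zero h3, h2.add_zero h4⟩

lemma IsOrderContinuous.sum {ι : Type*} {f : ι → A} (s : Finset ι)
    (hf : ∀ i, IsOrderContinuous (f i)) : IsOrderContinuous (∑ i ∈ s, f i) := by
  classical
  induction s using Finset.induction_on with
  | empty => simpa using IsOrderContinuous.zero
  | insert i s hi ih => rw [Finset.sum_insert hi]; exact (hf i).add ih

lemma IsOrderContinuous.OI_mul {a : A} (ha : IsOrderContinuous a) (p : OI A) :
    IsOrderContinuous ((p : A) * a) :=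
  ha.of_le (mul_nonneg p.nonneg ha.1) (by simpa using mul_le_mul_of_nonneg_right p.le_one ha.1)

lemma IsOrderContinuous.mul_OI {a : A} (ha : IsOrderContinuous a) (p : OI A) :
    IsOrderContinuous (a * (p : A)) :=
  ha.of_le (mul_nonneg ha.1 p.nonneg) (by simpa using mul_le_mul_of_nonneg_left p.le_one ha.1)

/-- A pointwise inequality of order idempotents is absorbed by multiplication. -/
lemma OI.mul_eq_left {p q : OI A} (h : (p : A) ≤ q) : (p : A) * q = p := by
  have h1 : (p : A) * (1 - q) ≤ q * (1 - q) :=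
    mul_le_mul_of_nonneg_right h (sub_nonneg.2 q.le_one)
  have h2 : 0 ≤ (p : A) * (1 - q) := mul_nonneg p.nonneg (sub_nonneg.2 q.le_one)
  rw [mul_sub, mul_one, mul_sub, mul_one, q.mul_self, sub_self] at h1
  rw [mul_sub, mul_one] at h2
  exact (sub_eq_zero.1 (le_antisymm h1 h2)).symm

lemma OI.mul_eq_right {p q : OI A} (h : (p : A) ≤ q) : (q : A) * p = p := by
  have h1 : (1 - (q : A)) * p ≤ (1 - q) * q :=
    mul_le_mul_of_nonneg_left h (sub_nonneg.2 q.le_one)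
  have h2 : 0 ≤ (1 - (q : A)) * p := mul_nonneg (sub_nonneg.2 q.le_one) p.nonneg
  rw [sub_mul, one_mul, sub_mul, one_mul, q.mul_self, sub_self] at h1
  rw [sub_mul, one_mul] at h2
  exact (sub_eq_zero.1 (le_antisymm h1 h2)).symm

/-- Order idempotents commute: both products equal `q * p * q`. -/
lemma OI.mul_comm (p q : OI A) : (p : A) * q = q * p := by
  have hq' : (0 : A) ≤ 1 - q := sub_nonneg.2 q.le_one
  have h1 : (1 - (q : A)) * p * q = 0 := by
    refine le_antisymm ?_ (mul_nonneg (mul_nonneg hq' p.nonneg) q.nonneg)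
    calc (1 - (q : A)) * p * q ≤ (1 - (q : A)) * 1 * q :=
          mul_le_mul_of_nonneg_right (mul_le_mul_of_nonneg_left p.le_one hq') q.nonneg
      _ = 0 := by rw [mul_one, sub_mul, one_mul, q.mul_self, sub_self]
  have h2 : (q : A) * p * (1 - q) = 0 := by
    refine le_antisymm ?_ (mul_nonneg (mul_nonneg q.nonneg p.nonneg) hq')
    calc (q : A) * p * (1 - q) ≤ q * 1 * (1 - q) :=
          mul_le_mul_of_nonneg_right (mul_le_mul_of_nonneg_left p.le_one q.nonneg) hq'
      _ = 0 := by rw [mul_one, mul_sub, mul_one, q.mul_self, sub_self]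
  rw [sub_mul, sub_mul, one_mul, sub_eq_zero] at h1
  rw [mul_sub, mul_one, sub_eq_zero] at h2
  rw [h1, ← h2]

/-- The Boolean complement `1 - p`. -/
def OI.compl (p : OI A) : OI A :=
  ⟨1 - (p : A), sub_nonneg.2 p.le_one, sub_le_self _ p.nonneg, by
    rw [mul_sub, mul_one, sub_mul, one_mul, p.mul_self, sub_self, sub_zero]⟩

/-- The infimum of two order idempotents, which is their product. -/
def OI.inf (p q : OI A) : OI A :=
  ⟨(p : A) * q, mul_nonneg p.nonneg q.nonneg, mul_le_one₀ p.le_one q.nonneg q.le_one, by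
    rw [mul_assoc, ← mul_assoc (q : A), ← OI.mul_comm p q, mul_assoc, q.mul_self, ← mul_assoc,
      p.mul_self]⟩

/-- The supremum of two order idempotents. -/
def OI.sup (p q : OI A) : OI A := (p.compl.inf q.compl).compl

lemma OI.coe_compl (p : OI A) : (p.compl : A) = 1 - p := rfl

lemma OI.coe_sup (p q : OI A) : (OI.sup p q : A) = p + q - p * q := by
  change 1 - (1 - (p : A)) * (1 - q) = _
  noncomm_ring

lemma OI.le_sup_left (p q : OI A) : p ≤ OI.sup p q := by
  change (p : A) ≤ (OI.sup p q : A)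
  have h : 0 ≤ (1 - (p : A)) * q := mul_nonneg (sub_nonneg.2 p.le_one) q.nonneg
  rw [sub_mul, one_mul] at h
  rw [coe_sup, add_sub_assoc]
  exact le_add_of_nonneg_right h

lemma OI.le_sup_right (p q : OI A) : q ≤ OI.sup p q := by
  change (q : A) ≤ (OI.sup p q : A)
  have h : 0 ≤ (p : A) * (1 - q) := mul_nonneg p.nonneg (sub_nonneg.2 q.le_one)
  rw [mul_sub, mul_one] at h
  rw [coe_sup, add_comm, add_sub_assoc]
  exact le_add_of_nonneg_right h

/-- The difference `q - p` of two order idempotents `p ≤ q`. -/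
def OI.sub (q p : OI A) (h : p ≤ q) : OI A :=
  ⟨(q : A) - p, sub_nonneg.2 h, (sub_le_self _ p.nonneg).trans q.le_one, by
    rw [mul_sub, sub_mul, sub_mul, q.mul_self, p.mul_self, OI.mul_eq_left h, OI.mul_eq_right h,
      sub_self, sub_zero]⟩

lemma IsOrderContinuous.pow_succ (hreg : IsOrderRegular A) {a : A} (ha : IsOrderContinuous a)
    (n : ℕ) : IsOrderContinuous (a ^ (n + 1)) := by
  induction n with
  | zero => simpa using ha
  | succ n ih => rw [_root_.pow_succ]; exact hreg _ _ ih ha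

variable [NormedAlgebra ℂ A]

lemma IsOrderContinuous.smul [PosSMulMono ℝ A] {a : A} (ha : IsOrderContinuous a) {c : ℝ}
    (hc : 0 ≤ c) : IsOrderContinuous (c • a) := by
  -- `c • a` is dominated by a natural multiple of `a`
  obtain ⟨n, hn⟩ := exists_nat_ge c
  refine (IsOrderContinuous.sum (f := fun _ => a) (Finset.range n) fun _ => ha).of_le
    (smul_nonneg hc ha.1) ?_
  rw [Finset.sum_const, Finset.card_range, ← Nat.cast_smul_eq_nsmul ℝ]
  exact smul_le_smul_of_nonneg_right hn ha.1

/-- The right annihilator of an order continuous element, among the order idempotents, has a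
largest element. -/
lemma exists_greatest_annihilator (hD : OIDedekindComplete A) {x : A} (hx : IsOrderContinuous x) :
    ∃ u : OI A, x * (u : A) = 0 ∧ ∀ w : OI A, x * (w : A) = 0 → (w : A) ≤ u := by
  let J : Set (OI A) := {u | x * (u : A) = 0}
  have h0J : (0 : OI A) ∈ J := mul_zero x
  obtain ⟨u, hu⟩ := hD J ⟨0, h0J⟩ ⟨1, fun p _ => p.le_one⟩
  refine ⟨u, ?_, fun w hw => hu.1 hw⟩
  have : Nonempty J := ⟨⟨0, h0J⟩⟩
  have : IsDirectedOrder J := by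
    refine ⟨fun p q => ⟨⟨OI.sup p.1 q.1, ?_⟩, OI.le_sup_left _ _, OI.le_sup_right _ _⟩⟩
    change x * (OI.sup p.1 q.1 : A) = 0
    have hp : x * (p.1 : A) = 0 := p.2
    have hq : x * (q.1 : A) = 0 := q.2
    rw [OI.coe_sup, mul_sub, mul_add, ← mul_assoc, hp, hq]
    simp
  -- the net `u - p`, `p ∈ J`, decreases to zero, and `x * (u - p) = x * u` is constant
  have hdec : DecreasesTo (fun p : J => OI.sub u p.1 (hu.1 p.2)) 0 := by
    refine ⟨fun p q hpq => sub_le_sub_left (show (p.1 : A) ≤ q.1 from hpq) _, ?_, fun w hw => ?_⟩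
    · rintro _ ⟨p, rfl⟩
      exact (OI.sub u p.1 (hu.1 p.2)).nonneg
    · have hw' : ∀ p : J, (w : A) ≤ u - p.1 := fun p => hw ⟨p, rfl⟩
      have hwu : w ≤ u := by
        have h := hw' ⟨0, h0J⟩
        change (w : A) ≤ (u : A) - 0 at h
        rwa [sub_zero] at h
      have h1 : u ≤ OI.sub u w hwu := by
        refine hu.2 fun p hp => ?_
        exact le_sub_comm.1 (hw' ⟨p, hp⟩)
      change (u : A) ≤ u - w at h1
      change (w : A) ≤ 0
      exact (le_sub_self_iff _).1 h1
  have h := (hx.2 J _ hdec).2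
  refine le_antisymm (h.2.2 ?_) (mul_nonneg hx.1 u.nonneg)
  rintro _ ⟨p, rfl⟩
  change x * (u : A) ≤ x * ((u : A) - p.1)
  have hp : x * (p.1 : A) = 0 := p.2
  rw [mul_sub, hp, sub_zero]

/-! ### Algebraically strictly positive elements -/

lemma IsAlgStrictlyPos.eq_zero_of_mul {b : A} (hb : IsAlgStrictlyPos b) {p q : OI A}
    (h : (p : A) * b * q = 0) : (p : A) = 0 ∨ (q : A) = 0 := by
  by_contra! hpq
  exact (hb p q (OI.pos_of_ne_zero hpq.1) (OI.pos_of_ne_zero hpq.2)).ne' h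

/-- With a disjunctive product, `p * b * y = 0` forces `y = 0` for order continuous `y`, `b` and
`p ≠ 0`, whenever `b ≫ 0`. -/
lemma IsAlgStrictlyPos.eq_zero_of_mul_right (hdisj : HasDisjunctiveProduct A) {b y : A}
    (hb : IsAlgStrictlyPos b) (hbc : IsOrderContinuous b) (hy : IsOrderContinuous y) {p : OI A}
    (hp : (p : A) ≠ 0) (h : (p : A) * b * y = 0) : y = 0 := by
  obtain ⟨u, hu1, hu2⟩ := hdisj _ _ (hbc.OI_mul p) hy h
  have hu : (u : A) = 0 := (hb.eq_zero_of_mul hu1).resolve_left hp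
  simpa [hu] using hu2

lemma IsAlgStrictlyPos.eq_zero_of_mul_left (hdisj : HasDisjunctiveProduct A) {b x : A}
    (hb : IsAlgStrictlyPos b) (hbc : IsOrderContinuous b) (hx : IsOrderContinuous x) {q : OI A}
    (hq : (q : A) ≠ 0) (h : x * (b * (q : A)) = 0) : x = 0 := by
  obtain ⟨u, hu1, hu2⟩ := hdisj _ _ hx (hbc.mul_OI q) h
  have hu : (u.compl : A) = 0 :=
    (hb.eq_zero_of_mul (by rw [OI.coe_compl, mul_assoc]; exact hu2)).resolve_right hq
  rw [OI.coe_compl, sub_eq_zero] at hu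
  rwa [← hu, mul_one] at hu1

/-- An order continuous `s` that dominates both `a` and `s * a` up to a factor is algebraically
strictly positive if `a` is irreducible: the largest `u` with `p * s * u = 0` is invariant
under `a`. -/
lemma IsIrreducible.isAlgStrictlyPos [PosSMulMono ℝ A] (hA1 : AxiomA1 A) {a s : A} {t : ℝ}
    (ha0 : a ≠ 0) (hac : IsOrderContinuous a)
    (hai : IsIrreducible a) (hs : IsOrderContinuous s) (has : a ≤ t • s) (hsa : s * a ≤ t • s) :
    IsAlgStrictlyPos s := by
  intro p q hp hq
  refine lt_of_le_of_ne (mul_nonneg (mul_nonneg p.nonneg hs.1) q.nonneg) fun h => ?_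
  obtain ⟨u, hu, hmax⟩ := exists_greatest_annihilator hA1.dedekindComplete (hs.OI_mul p)
  have hqu : (q : A) ≤ u := hmax q h.symm
  have hsau : (p : A) * s * (a * u) = 0 := by
    refine le_antisymm ?_ (mul_nonneg (mul_nonneg p.nonneg hs.1) (mul_nonneg hac.1 u.nonneg))
    calc (p : A) * s * (a * u) = p * (s * a) * u := by simp only [mul_assoc]
      _ ≤ p * (t • s) * u :=
        mul_le_mul_of_nonneg_right (mul_le_mul_of_nonneg_left hsa p.nonneg) u.nonneg
      _ = 0 := by rw [mul_smul_comm, smul_mul_assoc, hu, smul_zero]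
  obtain ⟨w, hw1, hw2⟩ := hA1.disjunctiveProduct _ _ (hs.OI_mul p) (hac.mul_OI u) hsau
  have hinv : (1 - (u : A)) * a * u = 0 := by
    refine le_antisymm (le_of_le_of_eq ?_ hw2)
      (mul_nonneg (mul_nonneg (sub_nonneg.2 u.le_one) hac.1) u.nonneg)
    rw [mul_assoc]
    exact mul_le_mul_of_nonneg_right (sub_le_sub_left (hmax w hw1) 1)
      (mul_nonneg hac.1 u.nonneg)
  rcases hai.2 u hinv with hu0 | hu1
  · rw [hu0] at hqu
    exact absurd (le_antisymm hqu q.nonneg) hq.ne'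
  · -- now `p * s = 0`, hence `p * a = 0`, so that `1 - p` is invariant under `a`
    rw [hu1, mul_one] at hu
    have hpa : (p : A) * a = 0 := by
      refine le_antisymm ?_ (mul_nonneg p.nonneg hac.1)
      calc (p : A) * a ≤ p * (t • s) := mul_le_mul_of_nonneg_left has p.nonneg
        _ = 0 := by rw [mul_smul_comm, hu, smul_zero]
    rcases hai.2 p.compl (by rw [OI.coe_compl, sub_sub_cancel, hpa, zero_mul]) with h1 | h1
    · rw [OI.coe_compl, sub_eq_zero] at h1
      rw [← h1, one_mul] at hpa
      exact ha0 hpa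
    · rw [OI.coe_compl, sub_eq_self] at h1
      exact hp.ne' h1

/-- Strict positivity passes from `s` to a non-zero element that `s` scales on both sides. -/
lemma IsAlgStrictlyPos.of_eigenvector [Nontrivial A] (hdisj : HasDisjunctiveProduct A) {s b : A}
    {c : ℝ} (hs : IsAlgStrictlyPos s) (hsc : IsOrderContinuous s) (hb : IsOrderContinuous b)
    (hb0 : b ≠ 0) (hsb : s * b = c • b) (hbs : b * s = c • b) : IsAlgStrictlyPos b := by
  intro p q hp hq
  refine lt_of_le_of_ne (mul_nonneg (mul_nonneg p.nonneg hb.1) q.nonneg) fun h => ?_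
  have h1 : b * (q : A) = 0 := by
    refine hs.eq_zero_of_mul_right hdisj hsc (hb.mul_OI q) hp.ne' ?_
    rw [← mul_assoc, mul_assoc (p : A), hsb, mul_smul_comm, smul_mul_assoc, ← h, smul_zero]
  refine hb0 (hs.eq_zero_of_mul_left hdisj hsc hb hq.ne' ?_)
  rw [← mul_assoc, hbs, smul_mul_assoc, h1, smul_zero]

/-- In the order ideal of a strictly positive `b` with `a b = b a = r b`, subinvariance
`r m ≤ a m` is invariance, because `b` annihilates the difference. -/
lemma mul_eq_smul_of_le [Nontrivial A] [PosSMulMono ℝ A] (hA1 : AxiomA1 A) {a b m : A}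
    {r : ℝ} (ha : 0 ≤ a) (hr : 0 ≤ r) (hbc : IsOrderContinuous b)
    (hb : IsAlgStrictlyPos b) (hab : a * b = r • b) (hba : b * a = r • b)
    (hm : m ∈ orderIdeal b) (hle : r • m ≤ a * m) (hm0 : 0 ≤ m) : a * m = r • m := by
  obtain ⟨t, ht, -, hmt⟩ := hm
  have hd : IsOrderContinuous (a * m - r • m) := by
    refine ((hbc.smul hr).smul ht).of_le (sub_nonneg.2 hle) ?_
    calc a * m - r • m ≤ a * m := sub_le_self _ (smul_nonneg hr hm0)
      _ ≤ a * (t • b) := mul_le_mul_of_nonneg_left hmt ha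
      _ = t • r • b := by rw [mul_smul_comm, hab]
  refine sub_eq_zero.1 (hb.eq_zero_of_mul_right hA1.disjunctiveProduct hbc hd (p := 1)
    (one_ne_zero (α := A)) ?_)
  change 1 * b * (a * m - r • m) = 0
  rw [one_mul, mul_sub, ← mul_assoc, hba, smul_mul_assoc, mul_smul_comm, sub_self]

lemma mul_eq_smul_of_le' [Nontrivial A] [PosSMulMono ℝ A] (hA1 : AxiomA1 A) {a b m : A}
    {r : ℝ} (ha : 0 ≤ a) (hr : 0 ≤ r) (hbc : IsOrderContinuous b)
    (hb : IsAlgStrictlyPos b) (hab : a * b = r • b) (hba : b * a = r • b)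
    (hm : m ∈ orderIdeal b) (hle : r • m ≤ m * a) (hm0 : 0 ≤ m) : m * a = r • m := by
  obtain ⟨t, ht, -, hmt⟩ := hm
  have hd : IsOrderContinuous (m * a - r • m) := by
    refine ((hbc.smul hr).smul ht).of_le (sub_nonneg.2 hle) ?_
    calc m * a - r • m ≤ m * a := sub_le_self _ (smul_nonneg hr hm0)
      _ ≤ (t • b) * a := mul_le_mul_of_nonneg_right hmt ha
      _ = t • r • b := by rw [smul_mul_assoc, hba]
  refine sub_eq_zero.1 (hb.eq_zero_of_mul_left hA1.disjunctiveProduct hbc hd (q := 1)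
    (one_ne_zero (α := A)) ?_)
  change (m * a - r • m) * (b * 1) = 0
  rw [mul_one, sub_mul, mul_assoc, hab, smul_mul_assoc, mul_smul_comm, sub_self]

end OrderContinuity

/-! ### Poles and the Neumann series of the resolvent -/

section Resolvent

variable {A : Type*} [NormedRing A] [NormedAlgebra ℂ A]

lemma resolvent_mul_sub {a : A} {z : ℂ} (hz : z ∉ spectrum ℂ a) :
    resolvent a z * (algebraMap ℂ A z - a) = 1 :=
  Ring.inverse_mul_cancel _ (spectrum.notMem_iff.1 hz)

lemma sub_mul_resolvent {a : A} {z : ℂ} (hz : z ∉ spectrum ℂ a) :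
    (algebraMap ℂ A z - a) * resolvent a z = 1 :=
  Ring.mul_inverse_cancel _ (spectrum.notMem_iff.1 hz)

lemma resolvent_mul_self {a : A} {z : ℂ} (hz : z ∉ spectrum ℂ a) :
    resolvent a z * a = z • resolvent a z - 1 := by
  have h := resolvent_mul_sub hz
  rw [mul_sub, ← Algebra.commutes, ← Algebra.smul_def] at h
  rw [← h, sub_sub_cancel]

lemma self_mul_resolvent {a : A} {z : ℂ} (hz : z ∉ spectrum ℂ a) :
    a * resolvent a z = z • resolvent a z - 1 := by
  have h := sub_mul_resolvent hz
  rw [sub_mul, ← Algebra.smul_def] at h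
  rw [← h, sub_sub_cancel]

lemma resolvent_mul_of_mul_eq_smul {a x : A} {z μ : ℂ} (hz : z ∉ spectrum ℂ a)
    (hx : a * x = μ • x) : (z - μ) • (resolvent a z * x) = x := by
  have h : (algebraMap ℂ A z - a) * x = (z - μ) • x := by
    rw [sub_mul, ← Algebra.smul_def, hx, sub_smul]
  rw [← mul_smul_comm, ← h, ← mul_assoc, resolvent_mul_sub hz, one_mul]

lemma mul_resolvent_of_mul_eq_smul {a x : A} {z μ : ℂ} (hz : z ∉ spectrum ℂ a)
    (hx : x * a = μ • x) : (z - μ) • (x * resolvent a z) = x := by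
  have h : x * (algebraMap ℂ A z - a) = (z - μ) • x := by
    rw [mul_sub, ← Algebra.commutes, ← Algebra.smul_def, hx, sub_smul]
  rw [← smul_mul_assoc, ← h, mul_assoc, sub_mul_resolvent hz, mul_one]

lemma mem_spectrum_of_mul_eq_smul {a x : A} {μ : ℂ} (hx0 : x ≠ 0) (hx : a * x = μ • x) :
    μ ∈ spectrum ℂ a := by
  by_contra hμ
  have h := resolvent_mul_of_mul_eq_smul hμ hx
  rw [sub_self, zero_smul] at h
  exact hx0 h.symm

/-- If the resolvent has a pole of order `k` at `z₀`, then `(z - z₀) ^ k • R(z, a)` tends to the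
leading Laurent coefficient. -/
lemma IsLaurentExpansion.tendsto_leading [CompleteSpace A] {a : A} {z₀ : ℂ} {c : ℤ → A} {k : ℕ}
    (hc : IsLaurentExpansion a z₀ c) (hk : ∀ j : ℤ, j < -(k : ℤ) → c j = 0) :
    Tendsto (fun z => (z - z₀) ^ k • resolvent a z) (𝓝[≠] z₀) (𝓝 (c (-(k : ℤ)))) := by
  let d : ℕ → A := fun n => c ((n : ℤ) - k)
  have hinj : Function.Injective (fun n : ℕ => (n : ℤ) - k) := fun m n h => by
    simpa using h
  have hsum : ∀ᶠ z in 𝓝[≠] z₀, HasSum (fun n : ℕ => (z - z₀) ^ n • d n)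
      ((z - z₀) ^ k • resolvent a z) := by
    filter_upwards [hc, self_mem_nhdsWithin] with z hz hne
    have hne' : z - z₀ ≠ 0 := sub_ne_zero.2 hne
    have h1 : HasSum (fun n : ℕ => (z - z₀) ^ ((n : ℤ) - k) • d n) (resolvent a z) := by
      refine (hinj.hasSum_iff (f := fun j : ℤ => (z - z₀) ^ j • c j) fun j hj => ?_).2 hz
      rw [hk j, smul_zero]
      by_contra! h
      exact hj ⟨(j + k).toNat, by dsimp only; omega⟩
    refine (h1.const_smul ((z - z₀) ^ k)).congr_fun ?_
    intro n
    rw [smul_smul, ← zpow_natCast, ← zpow_natCast, ← zpow_add₀ hne', add_sub_cancel]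
  -- the power series converges at some `w₀ ≠ 0`, hence uniformly on a smaller closed ball
  obtain ⟨z₁, hz₁, hne⟩ := (hsum.and self_mem_nhdsWithin).exists
  have hw₀ : 0 < ‖z₁ - z₀‖ := norm_pos_iff.2 (sub_ne_zero.2 hne)
  obtain ⟨C, hC⟩ := hz₁.summable.tendsto_atTop_zero.norm.bddAbove_range
  have hC' : ∀ n, ‖z₁ - z₀‖ ^ n * ‖d n‖ ≤ C := fun n => by
    simpa [norm_smul] using hC ⟨n, rfl⟩
  set ρ := ‖z₁ - z₀‖ / 2 with hρ
  have hρ0 : 0 < ρ := half_pos hw₀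
  have hcont : ContinuousOn (fun w : ℂ => ∑' n, w ^ n • d n) (Metric.closedBall 0 ρ) := by
    refine continuousOn_tsum (u := fun n => C * (1 / 2) ^ n)
      (fun n => ((continuous_id.pow n).smul continuous_const).continuousOn)
      (summable_geometric_two.mul_left C) fun n w hw => ?_
    have hw' : ‖w‖ ≤ ρ := by simpa using hw
    calc ‖w ^ n • d n‖ = ‖w‖ ^ n * ‖d n‖ := by rw [norm_smul, norm_pow]
      _ ≤ ρ ^ n * ‖d n‖ := by gcongr
      _ = (‖z₁ - z₀‖ ^ n * ‖d n‖) * (1 / 2) ^ n := by rw [hρ, div_pow, one_div, inv_pow]; ring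
      _ ≤ C * (1 / 2) ^ n := by gcongr; exact hC' n
  have hat : ContinuousAt (fun w : ℂ => ∑' n, w ^ n • d n) 0 :=
    hcont.continuousAt (Metric.closedBall_mem_nhds _ hρ0)
  have h0 : ∑' n, (0 : ℂ) ^ n • d n = c (-(k : ℤ)) := by
    rw [tsum_eq_single 0 fun n hn => by simp [hn]]
    simp [d]
  have hlim : Tendsto (fun z : ℂ => z - z₀) (𝓝[≠] z₀) (𝓝 0) := by
    have : Tendsto (fun z : ℂ => z - z₀) (𝓝 z₀) (𝓝 (z₀ - z₀)) :=
      (continuous_id.sub continuous_const).tendsto z₀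
    rw [sub_self] at this
    exact this.mono_left nhdsWithin_le_nhds
  rw [← h0]
  refine (hat.tendsto.comp hlim).congr' ?_
  filter_upwards [hsum] with z hz
  exact hz.tsum_eq

/-- The leading Laurent coefficient at a pole consists of eigenvectors, and its square is governed
by the order of the pole. -/
lemma IsIsolatedSpectralPoint.leading_properties {a h : A} {z₀ : ℂ} {k : ℕ}
    (hz₀ : IsIsolatedSpectralPoint a z₀)
    (hlim : Tendsto (fun z => (z - z₀) ^ (k + 1) • resolvent a z) (𝓝[≠] z₀) (𝓝 h)) :
    a * h = z₀ • h ∧ h * a = z₀ • h ∧ h * h = (0 : ℂ) ^ k • h := by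
  have hid : Tendsto (fun z : ℂ => z) (𝓝[≠] z₀) (𝓝 z₀) := nhdsWithin_le_nhds
  have hsub : Tendsto (fun z : ℂ => z - z₀) (𝓝[≠] z₀) (𝓝 0) := by
    simpa using hid.sub_const z₀
  have hpow : Tendsto (fun z : ℂ => (z - z₀) ^ (k + 1) • (1 : A)) (𝓝[≠] z₀) (𝓝 0) := by
    simpa using (hsub.pow (k + 1)).smul_const (1 : A)
  have hR : Tendsto
      (fun z => z • ((z - z₀) ^ (k + 1) • resolvent a z) - (z - z₀) ^ (k + 1) • (1 : A)) (𝓝[≠] z₀) (𝓝 (z₀ • h)) := by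
    simpa using (hid.smul hlim).sub hpow
  have hah : a * h = z₀ • h := by
    refine tendsto_nhds_unique ((tendsto_const_nhds.mul hlim).congr' ?_) hR
    filter_upwards [hz₀.2] with z hz
    rw [mul_smul_comm, self_mul_resolvent hz, smul_sub, smul_comm]
  refine ⟨hah, ?_, ?_⟩
  · refine tendsto_nhds_unique ((hlim.mul tendsto_const_nhds).congr' ?_) hR
    filter_upwards [hz₀.2] with z hz
    rw [smul_mul_assoc, resolvent_mul_self hz, smul_sub, smul_comm]
  · refine tendsto_nhds_unique ((hlim.mul tendsto_const_nhds).congr' ?_)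
      ((hsub.pow k).smul_const h)
    filter_upwards [hz₀.2] with z hz
    rw [smul_mul_assoc, pow_succ, mul_smul, resolvent_mul_of_mul_eq_smul hz hah]

lemma specRadius_nonneg (a : A) : 0 ≤ specRadius a := ENNReal.toReal_nonneg

variable [CompleteSpace A]

lemma spectralRadius_ne_top (a : A) : spectralRadius ℂ a ≠ ⊤ := by
  refine ne_top_of_le_ne_top (ENNReal.coe_ne_top (r := ‖a‖₊ * ‖(1 : A)‖₊)) ?_
  refine iSup₂_le fun z hz => ?_
  exact_mod_cast spectrum.norm_le_norm_mul_of_mem hz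

lemma notMem_spectrum_of_specRadius_lt {a : A} {z : ℂ} (hz : specRadius a < ‖z‖) :
    z ∉ spectrum ℂ a := by
  have h : spectralRadius ℂ a < (‖z‖₊ : ENNReal) :=
    (ENNReal.toReal_lt_toReal (spectralRadius_ne_top a) ENNReal.coe_ne_top).1 hz
  exact fun hmem => hmem (spectrum.mem_resolventSet_of_spectralRadius_lt h)

/-- Root test: by Gelfand's formula, the Neumann series converges absolutely outside the disc of
radius `r(a)`. -/
lemma summable_norm_pow_div {a : A} {t : ℝ} (ht : specRadius a < t) :
    Summable fun n : ℕ => ‖a ^ n‖ / t ^ (n + 1) := by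
  obtain ⟨q, hq1, hq2⟩ := exists_between ht
  have hq0 : 0 < q := (specRadius_nonneg a).trans_lt hq1
  have ht0 : 0 < t := hq0.trans hq2
  have hlt : limsup (fun n : ℕ => (‖a ^ n‖₊ : ENNReal) ^ (1 / n : ℝ)) atTop < ENNReal.ofReal q := by
    refine (spectrum.limsup_pow_nnnorm_pow_one_div_le_spectralRadius a).trans_lt ?_
    exact (ENNReal.lt_ofReal_iff_toReal_lt (spectralRadius_ne_top a)).2 hq1
  have hev : ∀ᶠ n : ℕ in atTop, ‖‖a ^ n‖ / t ^ (n + 1)‖ ≤ (q / t) ^ n * t⁻¹ := by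
    filter_upwards [eventually_lt_of_limsup_lt hlt, eventually_gt_atTop 0] with n hn hn0
    have hn' : (‖a ^ n‖₊ : ENNReal) ≤ ENNReal.ofReal q ^ n := by
      have h := ENNReal.rpow_le_rpow hn.le (Nat.cast_nonneg n : (0 : ℝ) ≤ n)
      rwa [← ENNReal.rpow_mul, one_div, inv_mul_cancel₀ (by exact_mod_cast hn0.ne'),
        ENNReal.rpow_one, ENNReal.rpow_natCast] at h
    have hn2 : ‖a ^ n‖ ≤ q ^ n := by
      rw [← ENNReal.ofReal_pow hq0.le] at hn'
      have := ENNReal.toReal_mono ENNReal.ofReal_ne_top hn'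
      rwa [ENNReal.toReal_ofReal (pow_nonneg hq0.le n)] at this
    rw [Real.norm_of_nonneg (by positivity), pow_succ, div_pow, ← div_div, div_eq_mul_inv _ t]
    gcongr
  refine Summable.of_norm_bounded_eventually_nat
    ((summable_geometric_of_lt_one (by positivity) ?_).mul_right _) hev
  exact (div_lt_one ht0).2 hq2

lemma summable_weighted_pow {a : A} {t : ℝ} (ht : specRadius a < t) {w : ℕ → ℂ}
    (hw : ∀ n, ‖w n‖ ≤ 1) : Summable fun n : ℕ => (w n / (t : ℂ) ^ (n + 1)) • a ^ n := by
  have ht0 : 0 < t := (specRadius_nonneg a).trans_lt ht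
  refine Summable.of_norm_bounded (summable_norm_pow_div ht) fun n => ?_
  rw [norm_smul, norm_div, norm_pow, Complex.norm_real, Real.norm_of_nonneg ht0.le,
    div_mul_eq_mul_div]
  gcongr
  exact mul_le_of_le_one_left (norm_nonneg _) (hw n)

/-- The Neumann series of the resolvent. -/
lemma hasSum_resolvent {a : A} {z : ℂ} (hz : specRadius a < ‖z‖) :
    HasSum (fun n : ℕ => (z ^ (n + 1))⁻¹ • a ^ n) (resolvent a z) := by
  have hz0 : z ≠ 0 := norm_pos_iff.1 ((specRadius_nonneg a).trans_lt hz)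
  have hs : Summable fun n : ℕ => (z ^ (n + 1))⁻¹ • a ^ n := by
    refine Summable.of_norm_bounded (summable_norm_pow_div hz) fun n => ?_
    rw [norm_smul, norm_inv, norm_pow, div_eq_inv_mul]
  have hshift : HasSum (fun n : ℕ => (z ^ (n + 1))⁻¹ • a ^ (n + 1))
      (z • ∑' n : ℕ, (z ^ (n + 1))⁻¹ • a ^ n - 1) := by
    have h := (hs.hasSum.const_smul z)
    have h' := (hasSum_nat_add_iff' 1).2 h
    have h0 : ∀ n : ℕ, z • (z ^ (n + 1))⁻¹ • a ^ n = (z ^ n)⁻¹ • a ^ n := fun n => by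
      rw [smul_smul, pow_succ, mul_inv, mul_comm, mul_assoc, inv_mul_cancel₀ hz0, mul_one]
    simp only [h0] at h'
    simpa using h'
  have hmul : (algebraMap ℂ A z - a) * ∑' n : ℕ, (z ^ (n + 1))⁻¹ • a ^ n = 1 := by
    have h : HasSum (fun n : ℕ => (z ^ (n + 1))⁻¹ • a ^ (n + 1))
        (a * ∑' n : ℕ, (z ^ (n + 1))⁻¹ • a ^ n) := by
      refine (hs.hasSum.mul_left a).congr_fun fun n => ?_
      rw [mul_smul_comm, pow_succ' a]
    rw [sub_mul, ← Algebra.smul_def, h.unique hshift, sub_sub_cancel]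
  have hR : resolvent a z = ∑' n : ℕ, (z ^ (n + 1))⁻¹ • a ^ n := by
    have h := resolvent_mul_sub (notMem_spectrum_of_specRadius_lt hz)
    rw [← mul_one (resolvent a z), ← hmul, ← mul_assoc, h, one_mul]
  rw [hR]
  exact hs.hasSum

lemma tendsto_radial (r : ℝ) {ζ : ℂ} (hζ : ζ ≠ 0) :
    Tendsto (fun t : ℝ => (t : ℂ) * ζ) (𝓝[>] r) (𝓝[≠] ((r : ℂ) * ζ)) := by
  refine tendsto_nhdsWithin_iff.2 ⟨?_, ?_⟩
  · exact ((Complex.continuous_ofReal.mul continuous_const).tendsto r).mono_left nhdsWithin_le_nhds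
  · filter_upwards [self_mem_nhdsWithin] with t ht h
    exact (ne_of_gt ht) (by exact_mod_cast mul_right_cancel₀ hζ h)

lemma hasSum_resolvent_real {a : A} {t : ℝ} (ht : specRadius a < t) :
    HasSum (fun n : ℕ => (t ^ (n + 1))⁻¹ • a ^ n) (resolvent a (t : ℂ)) := by
  have ht0 : 0 ≤ t := (specRadius_nonneg a).trans ht.le
  have h := hasSum_resolvent (a := a) (z := t) (by rwa [Complex.norm_of_nonneg ht0])
  refine h.congr_fun fun n => ?_
  rw [← Complex.coe_smul]
  push_cast
  rfl

/-- The residue `b` of the resolvent at `r(a)` fixes the eigenvectors to `r(a)`. -/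
lemma perron_mul_eq {a b m : A}
    (hlim : Tendsto (fun t : ℝ => (t - specRadius a) • resolvent a (t : ℂ)) (𝓝[>] specRadius a)
        (𝓝 b)) (ham : a * m = specRadius a • m) (hma : m * a = specRadius a • m) :
    b * m = m ∧ m * b = m := by
  have hz : ∀ᶠ t : ℝ in 𝓝[>] specRadius a, (t : ℂ) ∉ spectrum ℂ a := by
    filter_upwards [self_mem_nhdsWithin] with t ht
    refine notMem_spectrum_of_specRadius_lt ?_
    rwa [Complex.norm_of_nonneg ((specRadius_nonneg a).trans (le_of_lt ht))]
  rw [← Complex.coe_smul] at ham hma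
  refine ⟨tendsto_nhds_unique (hlim.mul_const m) (tendsto_const_nhds.congr' ?_),
    tendsto_nhds_unique (hlim.const_mul m) (tendsto_const_nhds.congr' ?_)⟩
  · filter_upwards [hz] with t ht
    rw [smul_mul_assoc, ← Complex.coe_smul, Complex.ofReal_sub, resolvent_mul_of_mul_eq_smul ht ham]
  · filter_upwards [hz] with t ht
    rw [mul_smul_comm, ← Complex.coe_smul, Complex.ofReal_sub, mul_resolvent_of_mul_eq_smul ht hma]

/-- A peripheral spectrum all of whose points are isolated in the spectrum is finite. -/
lemma finite_peripheralSpectrum {a : A} (h : ∀ z ∈ peripheralSpectrum a, IsPole a z) :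
    (peripheralSpectrum a).Finite := by
  by_contra hinf
  have hcpt : IsCompact (peripheralSpectrum a) :=
    (spectrum.isCompact a).inter_right (isClosed_eq continuous_norm continuous_const)
  obtain ⟨z, hz, hacc⟩ := Set.Infinite.exists_accPt_of_subset_isCompact hinf hcpt subset_rfl
  obtain ⟨k, -, ⟨-, hiso⟩, -⟩ := h z hz
  have hfreq := accPt_iff_frequently_nhdsNE.1 hacc
  exact hfreq (hiso.mono fun w hw hw' => hw hw'.1)

end Resolvent

/-! ### Regular elements and order ideals -/

section RegularElements

variable {A : Type*} [NormedRing A]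

lemma smul_add_I_smul [NormedAlgebra ℂ A] (ζ : ℂ) (f g : A) : ζ • (f + Complex.I • g) =
    (ζ.re • f - ζ.im • g) + Complex.I • (ζ.im • f + ζ.re • g) := by
  nth_rw 1 [← Complex.re_add_im ζ]
  simp only [← Complex.coe_smul (E := A), add_mul, add_smul, smul_add, smul_smul]
  have h1 : (ζ.im : ℂ) * Complex.I * Complex.I = -(ζ.im : ℂ) := by
    rw [mul_assoc, Complex.I_mul_I, mul_neg_one]
  rw [h1, neg_smul, mul_comm Complex.I, mul_comm Complex.I]
  abel

variable [PartialOrder A]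

lemma smul_mem_regularElements [NormedAlgebra ℂ A] [PosSMulMono ℝ A] {x : A} (c : ℝ)
    (hx : x ∈ regularElements A) :
    c • x ∈ regularElements A := by
  obtain ⟨x₁, x₂, h1, h2, rfl⟩ := hx
  rcases le_total 0 c with hc | hc
  · exact ⟨c • x₁, c • x₂, smul_nonneg hc h1, smul_nonneg hc h2, smul_sub _ _ _⟩
  · refine ⟨-c • x₂, -c • x₁, smul_nonneg (neg_nonneg.2 hc) h2, smul_nonneg (neg_nonneg.2 hc) h1, ?_⟩
    rw [neg_smul, neg_smul, smul_sub]
    abel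

lemma map_mem_regularElements [NormedAlgebra ℂ A] {S : A →ₗ[ℂ] A}
    (hS : ∀ y, 0 ≤ y → 0 ≤ S y) {x : A} (hx : x ∈ regularElements A) : S x ∈ regularElements A := by
  obtain ⟨x₁, x₂, h1, h2, rfl⟩ := hx
  exact ⟨S x₁, S x₂, hS _ h1, hS _ h2, map_sub _ _ _⟩

variable [IsOrderedRing A]

lemma sub_mem_regularElements {x y : A} (hx : x ∈ regularElements A) (hy : y ∈ regularElements A) :
    x - y ∈ regularElements A := by
  obtain ⟨x₁, x₂, h1, h2, rfl⟩ := hx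
  obtain ⟨y₁, y₂, h3, h4, rfl⟩ := hy
  exact ⟨x₁ + y₂, x₂ + y₁, add_nonneg h1 h4, add_nonneg h2 h3, by abel⟩

lemma add_mem_regularElements {x y : A} (hx : x ∈ regularElements A) (hy : y ∈ regularElements A) :
    x + y ∈ regularElements A := by
  obtain ⟨x₁, x₂, h1, h2, rfl⟩ := hx
  obtain ⟨y₁, y₂, h3, h4, rfl⟩ := hy
  exact ⟨x₁ + y₁, x₂ + y₂, add_nonneg h1 h3, add_nonneg h2 h4, by abel⟩

lemma mem_regularElements_of_mem_Icc {b f : A} (hb : 0 ≤ b) (hf : f ∈ Icc (-b) b) :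
    f ∈ regularElements A :=
  ⟨b, b - f, hb, sub_nonneg.2 hf.2, by rw [sub_sub_cancel]⟩

end RegularElements

/-! ### The Perron projection and the peripheral eigenvectors -/

section Positive

variable {A : Type*} [NormedRing A] [NormedAlgebra ℂ A] [CompleteSpace A]
    [PartialOrder A] [IsOrderedRing A] [PosSMulMono ℝ A] [OrderClosedTopology A]

lemma resolvent_nonneg {a : A} (ha : 0 ≤ a) {t : ℝ} (ht : specRadius a < t) :
    0 ≤ resolvent a (t : ℂ) := by
  have ht0 : 0 < t := (specRadius_nonneg a).trans_lt ht
  exact (hasSum_resolvent_real ht).nonneg fun n => smul_nonneg (by positivity) (pow_nonneg ha n)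

/-- The resolvent `R(t, a)` need not be order continuous, since `1` need not be, but `R(t, a) * a`
is. -/
lemma IsOrderContinuous.resolvent_mul (hA1 : AxiomA1 A) {a : A} (ha : IsOrderContinuous a) {t : ℝ}
    (ht : specRadius a < t) : IsOrderContinuous (resolvent a (t : ℂ) * a) := by
  have ht0 : 0 < t := (specRadius_nonneg a).trans_lt ht
  refine hA1.isClosed.mem_of_tendsto ((hasSum_resolvent_real ht).mul_right a)
    (Eventually.of_forall fun s => IsOrderContinuous.sum s fun n => ?_)
  rw [smul_mul_assoc, ← _root_.pow_succ]
  exact (ha.pow_succ hA1.orderRegular n).smul (by positivity)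

lemma isAlgStrictlyPos_resolvent_mul (hA1 : AxiomA1 A) {a : A} (ha0 : a ≠ 0)
    (hac : IsOrderContinuous a) (hai : IsIrreducible a) {t : ℝ} (ht : specRadius a < t) :
    IsAlgStrictlyPos (resolvent a (t : ℂ) * a) := by
  have hz : (t : ℂ) ∉ spectrum ℂ a := notMem_spectrum_of_specRadius_lt <| by
    rwa [Complex.norm_of_nonneg ((specRadius_nonneg a).trans ht.le)]
  have hs := hac.resolvent_mul hA1 ht
  have h : resolvent a (t : ℂ) * a * a = t • (resolvent a (t : ℂ) * a) - a := by
    nth_rw 1 [resolvent_mul_self hz]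
    rw [sub_mul, one_mul, smul_mul_assoc, Complex.coe_smul]
  have h0 : 0 ≤ resolvent a (t : ℂ) * a * a := mul_nonneg hs.1 hac.1
  refine hai.isAlgStrictlyPos hA1 (t := t) ha0 hac hs ?_ ?_
  · rwa [h, sub_nonneg] at h0
  · rw [h]
    exact sub_le_self _ hac.1

/-- The Perron projection: the pole at `r(a) > 0` is simple and its residue is a strictly positive
order continuous idempotent. -/
lemma exists_perron_projection [Nontrivial A] (hA1 : AxiomA1 A) {a : A} (ha0 : a ≠ 0)
    (hac : IsOrderContinuous a) (hai : IsIrreducible a) (hap : IsPole a (specRadius a : ℂ))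
    (hr : 0 < specRadius a) :
    ∃ b : A, IsOrderContinuous b ∧ IsAlgStrictlyPos b ∧ b * b = b ∧
      a * b = specRadius a • b ∧ b * a = specRadius a • b ∧ IsResidue a (specRadius a : ℂ) b ∧
      Tendsto (fun t : ℝ => (t - specRadius a) • resolvent a (t : ℂ)) (𝓝[>] specRadius a)
        (𝓝 b) := by
  set r := specRadius a with hrdef
  obtain ⟨k, hk1, hiso, c, hc, hck, hc0⟩ := hap
  obtain ⟨k, rfl⟩ : ∃ m, k = m + 1 := ⟨k - 1, by omega⟩
  have hlim := hc.tendsto_leading hck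
  obtain ⟨hab, hba, hbb⟩ := hiso.leading_properties hlim
  set b := c (-((k + 1 : ℕ) : ℤ)) with hb
  have hrad : Tendsto (fun t : ℝ => (t : ℂ)) (𝓝[>] r) (𝓝[≠] (r : ℂ)) := by
    simpa using tendsto_radial r one_ne_zero
  have hlim' : Tendsto (fun t : ℝ => (t - r) ^ (k + 1) • resolvent a (t : ℂ)) (𝓝[>] r) (𝓝 b) := by
    refine (hlim.comp hrad).congr fun t => ?_
    rw [Function.comp_apply, ← Complex.coe_smul ((t - r) ^ (k + 1))]
    push_cast
    rfl
  have hsub : Tendsto (fun t : ℝ => t - r) (𝓝[>] r) (𝓝 0) := by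
    simpa using ((continuous_id (X := ℝ)).tendsto r |>.mono_left nhdsWithin_le_nhds).sub_const r
  have hinv : Tendsto (fun t : ℝ => t⁻¹) (𝓝[>] r) (𝓝 r⁻¹) :=
    (tendsto_inv₀ hr.ne').mono_left nhdsWithin_le_nhds
  -- `b` is also the limit of the order continuous elements `t⁻¹ (t - r) ^ (k + 1) R(t, a) a`
  have hbc : IsOrderContinuous b := by
    have h : Tendsto (fun t : ℝ => t⁻¹ • (t - r) ^ (k + 1) • (resolvent a (t : ℂ) * a)) (𝓝[>] r)
        (𝓝 b) := by
      have h1 := hinv.smul (hlim'.mul_const a)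
      rw [hba, Complex.coe_smul, smul_smul, inv_mul_cancel₀ hr.ne', one_smul] at h1
      simpa only [smul_mul_assoc] using h1
    refine hA1.isClosed.mem_of_tendsto h ?_
    filter_upwards [self_mem_nhdsWithin] with t ht
    have ht' : r < t := ht
    have : 0 < t := hr.trans ht'
    exact ((hac.resolvent_mul hA1 ht).smul (pow_nonneg (sub_nonneg.2 ht'.le) _)).smul
      (by positivity)
  have hbpos : IsAlgStrictlyPos b := by
    have ht : r < r + 1 := lt_add_one r
    have hz : ((r + 1 : ℝ) : ℂ) ∉ spectrum ℂ a := notMem_spectrum_of_specRadius_lt <| by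
      rwa [Complex.norm_of_nonneg (by positivity)]
    have hone : ((r + 1 : ℝ) : ℂ) - r = 1 := by push_cast; ring
    have h1 := resolvent_mul_of_mul_eq_smul hz hab
    have h2 := mul_resolvent_of_mul_eq_smul hz hba
    rw [hone, one_smul] at h1 h2
    refine (isAlgStrictlyPos_resolvent_mul hA1 ha0 hac hai ht).of_eigenvector (c := r)
      hA1.disjunctiveProduct (hac.resolvent_mul hA1 ht) hbc hc0 ?_ ?_
    · rw [mul_assoc, hab, mul_smul_comm, h1, Complex.coe_smul]
    · rw [← mul_assoc, h2, hba, Complex.coe_smul]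
  -- a pole of higher order would make `b` a nilpotent element
  obtain rfl : k = 0 := by
    by_contra hk
    rw [zero_pow hk, zero_smul] at hbb
    refine hc0 (hbpos.eq_zero_of_mul_right hA1.disjunctiveProduct hbc hbc
      (p := 1) (one_ne_zero (α := A)) ?_)
    change 1 * b * b = 0
    rw [one_mul, hbb]
  refine ⟨b, hbc, hbpos, by simpa using hbb, by rw [hab, Complex.coe_smul],
    by rw [hba, Complex.coe_smul], ⟨c, hc, by simp [hb]⟩, by simpa using hlim'⟩

/-- On the circle of radius `t > r(a)`, the resolvent splits into regular parts that are
dominated by `R(t, a)`. -/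
lemma exists_resolvent_decomposition {a : A} (ha : 0 ≤ a) {t : ℝ} (ht : specRadius a < t) {ζ : ℂ}
    (hζ : ‖ζ‖ = 1) : ∃ f g : A, ζ • resolvent a ((t : ℂ) * ζ) = f + Complex.I • g ∧
      f ∈ Icc (-resolvent a (t : ℂ)) (resolvent a (t : ℂ)) ∧
      g ∈ Icc (-resolvent a (t : ℂ)) (resolvent a (t : ℂ)) := by
  have ht0 : 0 < t := (specRadius_nonneg a).trans_lt ht
  have hζ0 : ζ ≠ 0 := norm_ne_zero_iff.1 (by rw [hζ]; exact one_ne_zero)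
  have hnorm : ∀ n : ℕ, ‖(ζ⁻¹) ^ n‖ = 1 := fun n => by rw [norm_pow, norm_inv, hζ]; simp
  have key : ∀ w : ℕ → ℝ, (∀ n, |w n| ≤ 1) → ∃ f : A,
      HasSum (fun n : ℕ => (w n / t ^ (n + 1)) • a ^ n) f ∧
        f ∈ Icc (-resolvent a (t : ℂ)) (resolvent a (t : ℂ)) := by
    intro w hw
    have hs : Summable fun n : ℕ => (w n / t ^ (n + 1)) • a ^ n := by
      refine (summable_weighted_pow ht (w := fun n => (w n : ℂ)) fun n => ?_).congr fun n => ?_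
      · rw [Complex.norm_real]
        exact hw n
      · rw [← Complex.coe_smul]
        push_cast
        rfl
    refine ⟨_, hs.hasSum, hasSum_le (fun n => ?_) (hasSum_resolvent_real ht).neg hs.hasSum,
      hasSum_le (fun n => ?_) hs.hasSum (hasSum_resolvent_real ht)⟩
    · rw [← neg_smul]
      refine smul_le_smul_of_nonneg_right ?_ (pow_nonneg ha n)
      rw [← one_div, ← neg_div]
      gcongr
      exact (abs_le.1 (hw n)).1
    · refine smul_le_smul_of_nonneg_right ?_ (pow_nonneg ha n)
      rw [← one_div]
      gcongr
      exact (abs_le.1 (hw n)).2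
  obtain ⟨f, hf, hf'⟩ := key (fun n => ((ζ⁻¹) ^ n).re) fun n =>
    (Complex.abs_re_le_norm _).trans (hnorm n).le
  obtain ⟨g, hg, hg'⟩ := key (fun n => ((ζ⁻¹) ^ n).im) fun n =>
    (Complex.abs_im_le_norm _).trans (hnorm n).le
  refine ⟨f, g, ?_, hf', hg'⟩
  have hR := (hasSum_resolvent (a := a) (z := t * ζ) (by
    rwa [norm_mul, hζ, mul_one, Complex.norm_of_nonneg ht0.le])).const_smul ζ
  refine hR.unique ((hf.add (hg.const_smul Complex.I)).congr_fun fun n => ?_)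
  rw [← Complex.coe_smul, ← Complex.coe_smul, smul_smul, smul_smul, ← add_smul]
  congr 1
  push_cast
  have h := Complex.re_add_im ((ζ⁻¹) ^ n)
  have h2 : ζ * ((t * ζ) ^ (n + 1))⁻¹ = (ζ⁻¹) ^ n / (t : ℂ) ^ (n + 1) := by
    have : (t : ℂ) ≠ 0 := by exact_mod_cast ht0.ne'
    rw [inv_pow, mul_pow, pow_succ ζ]
    field_simp
  rw [h2]
  nth_rw 1 [← h]
  ring

/-- At a peripheral pole, the leading Laurent coefficient is, up to a unimodular factor, of the
form `f + i g` with `f` and `g` dominated by the Perron projection. -/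
lemma exists_peripheral_eigenvector (hA5 : AxiomA5 A) {a b : A} (ha : 0 ≤ a)
    (hb : Tendsto (fun t : ℝ => (t - specRadius a) • resolvent a (t : ℂ)) (𝓝[>] specRadius a)
        (𝓝 b)) {ζ : ℂ} (hζ : ‖ζ‖ = 1) (hp : IsPole a ((specRadius a : ℂ) * ζ)) :
    ∃ f g : A, f ∈ Icc (-b) b ∧ g ∈ Icc (-b) b ∧ f + Complex.I • g ≠ 0 ∧
      a * (f + Complex.I • g) = ((specRadius a : ℂ) * ζ) • (f + Complex.I • g) ∧
      (f + Complex.I • g) * a = ((specRadius a : ℂ) * ζ) • (f + Complex.I • g) := by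
  set r := specRadius a with hrdef
  have hζ0 : ζ ≠ 0 := norm_ne_zero_iff.1 (by rw [hζ]; exact one_ne_zero)
  obtain ⟨k, hk1, hiso, c, hc, hck, hc0⟩ := hp
  obtain ⟨k, rfl⟩ : ∃ m, k = m + 1 := ⟨k - 1, by omega⟩
  have hlim := hc.tendsto_leading hck
  obtain ⟨hac, hca, -⟩ := hiso.leading_properties hlim
  set h := c (-((k + 1 : ℕ) : ℤ)) with hh
  -- approach the pole radially, along a sequence `t n ↓ r`
  obtain ⟨t, -, ht1, ht2⟩ := exists_seq_strictAnti_tendsto' (show r < r + 1 by linarith)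
  have ht : Tendsto t atTop (𝓝[>] r) :=
    tendsto_nhdsWithin_iff.2 ⟨ht2, Eventually.of_forall fun n => (ht1 n).1⟩
  choose F G hFG hF hG using fun n => exists_resolvent_decomposition ha (ht1 n).1 hζ
  have hlim1 : Tendsto (fun n => (t n - r) ^ (k + 1) • F n +
      Complex.I • ((t n - r) ^ (k + 1) • G n)) atTop (𝓝 ((ζ ^ k)⁻¹ • h)) := by
    have h1 := ((hlim.comp (tendsto_radial r hζ0)).comp ht).const_smul (ζ ^ k)⁻¹
    refine h1.congr fun n => ?_
    rw [smul_comm Complex.I, ← smul_add, ← hFG, ← Complex.coe_smul]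
    simp only [Function.comp_apply]
    rw [smul_smul, smul_smul, ← sub_mul, mul_pow]
    congr 1
    push_cast
    rw [pow_succ ζ, mul_left_comm, inv_mul_cancel_left₀ (pow_ne_zero k hζ0)]
  have hdom : ∀ {X : ℕ → A}, (∀ n, X n ∈ Icc (-resolvent a (t n : ℂ)) (resolvent a (t n : ℂ))) →
      ∀ n, (t n - r) ^ (k + 1) • X n ∈
        Icc (-((t n - r) • resolvent a (t n : ℂ))) ((t n - r) • resolvent a (t n : ℂ)) := by
    intro X hX n
    have h0 : 0 ≤ t n - r := sub_nonneg.2 (ht1 n).1.le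
    have hle : (t n - r) ^ (k + 1) ≤ t n - r :=
      pow_le_of_le_one h0 (by linarith [(ht1 n).2]) k.succ_ne_zero
    have h2 : (t n - r) ^ (k + 1) • resolvent a (t n : ℂ) ≤ (t n - r) • resolvent a (t n : ℂ) :=
      smul_le_smul_of_nonneg_right hle (resolvent_nonneg ha (ht1 n).1)
    have h3 := smul_le_smul_of_nonneg_left (hX n).1 (pow_nonneg h0 (k + 1))
    have h4 := smul_le_smul_of_nonneg_left (hX n).2 (pow_nonneg h0 (k + 1))
    rw [smul_neg] at h3
    exact ⟨(neg_le_neg h2).trans h3, h4.trans h2⟩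
  have hreg : ∀ {X : ℕ → A}, (∀ n, X n ∈ Icc (-resolvent a (t n : ℂ)) (resolvent a (t n : ℂ))) →
      ∀ n, (t n - r) ^ (k + 1) • X n ∈ regularElements A := fun hX n =>
    mem_regularElements_of_mem_Icc
      (smul_nonneg (sub_nonneg.2 (ht1 n).1.le) (resolvent_nonneg ha (ht1 n).1)) (hdom hX n)
  obtain ⟨⟨f, hf⟩, ⟨g, hg⟩⟩ := hA5 _ _ (hreg hF) (hreg hG) ⟨_, hlim1⟩
  have hfg : f + Complex.I • g = (ζ ^ k)⁻¹ • h :=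
    tendsto_nhds_unique (hf.add (hg.const_smul Complex.I)) hlim1
  have hbt := hb.comp ht
  refine ⟨f, g, ⟨le_of_tendsto_of_tendsto' hbt.neg hf fun n => (hdom hF n).1,
    le_of_tendsto_of_tendsto' hf hbt fun n => (hdom hF n).2⟩,
    ⟨le_of_tendsto_of_tendsto' hbt.neg hg fun n => (hdom hG n).1,
    le_of_tendsto_of_tendsto' hg hbt fun n => (hdom hG n).2⟩, ?_, ?_, ?_⟩
  · rw [hfg]
    exact smul_ne_zero (inv_ne_zero (pow_ne_zero _ hζ0)) hc0
  · rw [hfg, mul_smul_comm, hac, smul_comm]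
  · rw [hfg, smul_mul_assoc, hca, smul_comm]

end Positive

/-! ### Markov operators on spaces of continuous functions -/

section Markov

variable {K : Type*} [TopologicalSpace K]

/-- Cauchy-Schwarz for a positive functional, in the degenerate case. -/
lemma map_mul_eq_zero_of_map_mul_self {φ : C(K, ℝ) →ₗ[ℝ] ℝ} (hφ : ∀ f, 0 ≤ f → 0 ≤ φ f)
    {v : C(K, ℝ)} (hv : φ (v * v) = 0) (u : C(K, ℝ)) : φ (v * u) = 0 := by
  have h : ∀ s : ℝ, 0 ≤ φ (u * u) * (s * s) + 2 * φ (v * u) * s + 0 := fun s => by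
    have h1 : 0 ≤ φ ((v + s • u) * (v + s • u)) :=
      hφ _ fun x => mul_self_nonneg (v x + s * u x)
    have h2 : (v + s • u) * (v + s • u) = v * v + (2 * s) • (v * u) + (s * s) • (u * u) := by
      ext x
      simp only [ContinuousMap.add_apply, ContinuousMap.mul_apply, ContinuousMap.smul_apply,
        smul_eq_mul]
      ring
    rw [h2, map_add, map_add, map_smul, map_smul, hv, smul_eq_mul, smul_eq_mul] at h1
    linarith
  have h3 := discrim_le_zero h
  rw [discrim] at h3
  exact pow_eq_zero_iff two_ne_zero |>.1 (le_antisymm (by linarith) (sq_nonneg (φ (v * u))))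

/-- A normalized positive functional that maps the unimodular function `f + i g` to a unimodular
number is multiplicative at `f` and at `g`, because `f` and `g` are almost everywhere constant
for the associated measure. -/
lemma map_mul_of_unimodular {φ : C(K, ℝ) →ₗ[ℝ] ℝ} (hφ : ∀ f, 0 ≤ f → 0 ≤ φ f) (h1 : φ 1 = 1)
    {f g : C(K, ℝ)} (hfg : f * f + g * g = 1) (hm : φ f * φ f + φ g * φ g = 1) (u : C(K, ℝ)) :
    φ (f * u) = φ f * φ u ∧ φ (g * u) = φ g * φ u := by
  have hexp : ∀ w : C(K, ℝ), (w - φ w • 1) * (w - φ w • 1) =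
      w * w - (2 * φ w) • w + (φ w * φ w) • 1 := fun w => by
    ext x
    simp only [ContinuousMap.add_apply, ContinuousMap.mul_apply, ContinuousMap.smul_apply,
      ContinuousMap.sub_apply, ContinuousMap.one_apply, smul_eq_mul]
    ring
  have hval : ∀ w : C(K, ℝ), φ ((w - φ w • 1) * (w - φ w • 1)) = φ (w * w) - φ w * φ w := by
    intro w
    rw [hexp, map_add, map_sub, map_smul, map_smul, h1, smul_eq_mul, smul_eq_mul]
    ring
  have hpos : ∀ w : C(K, ℝ), 0 ≤ φ ((w - φ w • 1) * (w - φ w • 1)) := fun w =>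
    hφ _ fun x => mul_self_nonneg _
  have hsum : φ (f * f) + φ (g * g) = 1 := by rw [← map_add, hfg, h1]
  have hf := hpos f
  have hg := hpos g
  have hmul : ∀ w : C(K, ℝ), φ ((w - φ w • 1) * (w - φ w • 1)) = 0 → φ (w * u) = φ w * φ u :=
    fun w hw => by
      have h := map_mul_eq_zero_of_map_mul_self hφ hw u
      rwa [sub_mul, smul_mul_assoc, one_mul, map_sub, map_smul, smul_eq_mul, sub_eq_zero] at h
  refine ⟨hmul f ?_, hmul g ?_⟩
  · rw [hval] at hf hg ⊢
    linarith
  · rw [hval] at hf hg ⊢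
    linarith

/-- `f + i g` satisfies `T (f + i g) = ζ (f + i g)`, in terms of real and imaginary parts. -/
def IsEigenpair {E : Type*} [AddCommGroup E] [Module ℝ E] (T : E →ₗ[ℝ] E) (ζ : ℂ) (f g : E) :
    Prop :=
  T f = ζ.re • f - ζ.im • g ∧ T g = ζ.im • f + ζ.re • g

/-- Evaluation at `x` after `T`, a functional that inherits positivity from `T`. -/
def evalAfter (T : C(K, ℝ) →ₗ[ℝ] C(K, ℝ)) (x : K) : C(K, ℝ) →ₗ[ℝ] ℝ where
  toFun f := T f x
  map_add' f g := by rw [map_add, ContinuousMap.add_apply]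
  map_smul' c f := by rw [map_smul, ContinuousMap.smul_apply, RingHom.id_apply]

lemma evalAfter_apply (T : C(K, ℝ) →ₗ[ℝ] C(K, ℝ)) (x : K) (f : C(K, ℝ)) :
    evalAfter T x f = T f x := rfl

/-- The modulus of `f + i g`. -/
noncomputable def modulus (f g : C(K, ℝ)) : C(K, ℝ) :=
  ⟨fun x => √(f x * f x + g x * g x), by fun_prop⟩

lemma modulus_apply (f g : C(K, ℝ)) (x : K) : modulus f g x = √(f x * f x + g x * g x) := rfl

variable {T : C(K, ℝ) →ₗ[ℝ] C(K, ℝ)}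

lemma IsEigenpair.apply {ζ : ℂ} {f g : C(K, ℝ)} (h : IsEigenpair T ζ f g) (x : K) :
    evalAfter T x f = ζ.re * f x - ζ.im * g x ∧ evalAfter T x g = ζ.im * f x + ζ.re * g x := by
  simp [evalAfter_apply, h.1, h.2]

lemma re_sq_add_im_sq {ζ : ℂ} (hζ : ‖ζ‖ = 1) : ζ.re * ζ.re + ζ.im * ζ.im = 1 := by
  rw [← Complex.normSq_apply, Complex.normSq_eq_norm_sq, hζ, one_pow]

/-- The modulus of an eigenvector of a positive operator to a unimodular eigenvalue is
subinvariant. -/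
lemma IsEigenpair.modulus_le (hT : ∀ f, 0 ≤ f → 0 ≤ T f) {ζ : ℂ} (hζ : ‖ζ‖ = 1) {f g : C(K, ℝ)}
    (h : IsEigenpair T ζ f g) : modulus f g ≤ T (modulus f g) := by
  intro x
  obtain ⟨hf, hg⟩ := h.apply x
  set α := evalAfter T x f
  set β := evalAfter T x g
  have hζ' := re_sq_add_im_sq hζ
  have hsq : α * α + β * β = f x * f x + g x * g x := by
    rw [hf, hg]
    linear_combination (f x * f x + g x * g x) * hζ'
  set ρ := √(f x * f x + g x * g x) with hρ
  have hρ2 : ρ * ρ = α * α + β * β := by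
    rw [hsq]
    exact Real.mul_self_sqrt (by nlinarith [mul_self_nonneg (f x), mul_self_nonneg (g x)])
  -- `α f + β g ≤ ρ |f + i g|` pointwise
  have hle : 0 ≤ ρ • modulus f g - (α • f + β • g) := by
    intro y
    change 0 ≤ ρ * √(f y * f y + g y * g y) - (α * f y + β * g y)
    rw [sub_nonneg, hρ, ← hsq, ← Real.sqrt_mul (by nlinarith [mul_self_nonneg α, mul_self_nonneg β])]
    refine Real.le_sqrt_of_sq_le ?_
    nlinarith [mul_self_nonneg (α * g y - β * f y)]
  have h1 : 0 ≤ evalAfter T x (ρ • modulus f g - (α • f + β • g)) := hT _ hle x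
  rw [map_sub, map_smul, map_add, map_smul, map_smul, smul_eq_mul, smul_eq_mul, smul_eq_mul,
    ← hρ2, sub_nonneg] at h1
  change ρ ≤ evalAfter T x (modulus f g)
  have hρ0 : 0 ≤ ρ := Real.sqrt_nonneg _
  rcases hρ0.eq_or_lt with h0 | h0
  · rw [← h0]
    exact hT (modulus f g) (fun y => Real.sqrt_nonneg (f y * f y + g y * g y)) x
  · exact le_of_mul_le_mul_left h1 h0

/-- Eigenvectors of constant modulus to unimodular eigenvalues of a Markov operator can be
multiplied by the conjugates of one another. -/
lemma IsEigenpair.mul_conj (hT : ∀ f, 0 ≤ f → 0 ≤ T f) (hT1 : T 1 = 1) {ζ η : ℂ} (hζ : ‖ζ‖ = 1)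
    {f g f' g' : C(K, ℝ)} (hfg : f * f + g * g = 1)
    (h : IsEigenpair T ζ f g) (h' : IsEigenpair T η f' g') :
    IsEigenpair T (ζ * star η) (f * f' + g * g') (g * f' - f * g') := by
  have key : ∀ x, ∀ u, evalAfter T x (f * u) = evalAfter T x f * evalAfter T x u ∧
      evalAfter T x (g * u) = evalAfter T x g * evalAfter T x u := fun x u => by
    refine map_mul_of_unimodular (fun w hw => hT w hw x) ?_ hfg ?_ u
    · rw [evalAfter_apply, hT1, ContinuousMap.one_apply]
    · obtain ⟨hf, hg⟩ := h.apply x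
      have hx : f x * f x + g x * g x = 1 := congrArg (fun w : C(K, ℝ) => w x) hfg
      rw [hf, hg]
      linear_combination (f x * f x + g x * g x) * re_sq_add_im_sq hζ + hx
  constructor
  · ext x
    rw [← evalAfter_apply, map_add, (key x f').1, (key x g').2, (h.apply x).1, (h.apply x).2,
      (h'.apply x).1, (h'.apply x).2]
    simp
    ring
  · ext x
    rw [← evalAfter_apply, map_sub, (key x f').2, (key x g').1, (h.apply x).1, (h.apply x).2,
      (h'.apply x).1, (h'.apply x).2]
    simp
    ring

end Markov

/-! ### Finite groups of unimodular numbers -/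

section Roots

/-- A finite non-empty set of unimodular numbers that is closed under `(ζ, η) ↦ ζ * conj η` is the
group of all `m`-th roots of unity. -/
lemma exists_eq_rootsOfUnitySet {S : Set ℂ} (hfin : S.Finite) (hne : S.Nonempty)
    (hnorm : ∀ ζ ∈ S, ‖ζ‖ = 1) (hmul : ∀ ζ ∈ S, ∀ η ∈ S, ζ * star η ∈ S) :
    ∃ m : ℕ, 1 ≤ m ∧ S = rootsOfUnitySet m := by
  have hstar : ∀ ζ ∈ S, ζ * star ζ = 1 := fun ζ hζ => by
    rw [Complex.star_def, Complex.mul_conj, Complex.normSq_eq_norm_sq, hnorm ζ hζ]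
    simp
  obtain ⟨ζ₀, hζ₀⟩ := hne
  have hone : (1 : ℂ) ∈ S := hstar ζ₀ hζ₀ ▸ hmul ζ₀ hζ₀ ζ₀ hζ₀
  have hconj : ∀ ζ ∈ S, star ζ ∈ S := fun ζ hζ => by simpa using hmul 1 hone ζ hζ
  let H : Subgroup ℂˣ :=
    { carrier := {u | (u : ℂ) ∈ S}
      mul_mem' := fun {u v} hu hv => by
        simpa using hmul _ hu _ (hconj _ hv)
      one_mem' := by simpa using hone
      inv_mem' := fun {u} hu => by
        change ((u⁻¹ : ℂˣ) : ℂ) ∈ S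
        have : ((u⁻¹ : ℂˣ) : ℂ) = star (u : ℂ) := Units.inv_eq_of_mul_eq_one_right (hstar _ hu)
        rw [this]
        exact hconj _ hu }
  have : Finite H :=
    (hfin.preimage (f := fun u : ℂˣ => (u : ℂ)) Units.val_injective.injOn).to_subtype
  set m := Nat.card H with hm
  have hm0 : 0 < m := Nat.card_pos
  have : NeZero m := ⟨hm0.ne'⟩
  have hle : H ≤ rootsOfUnity m ℂ := fun u hu => by
    rw [mem_rootsOfUnity]
    exact congrArg Subtype.val (pow_card_eq_one' (x := (⟨u, hu⟩ : H)))
  have hH : H = rootsOfUnity m ℂ :=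
    Subgroup.eq_of_le_of_card_ge hle (by rw [Complex.card_rootsOfUnity])
  refine ⟨m, hm0, Set.ext fun z => ⟨fun hz => ?_, fun hz => ?_⟩⟩
  · have hz0 : z ≠ 0 := norm_ne_zero_iff.1 (by rw [hnorm z hz]; exact one_ne_zero)
    have h : Units.mk0 z hz0 ∈ rootsOfUnity m ℂ := hH ▸ (show Units.mk0 z hz0 ∈ H from hz)
    rw [mem_rootsOfUnity'] at h
    exact h
  · have hz' : z ^ m = 1 := hz
    have hz0 : z ≠ 0 := fun h => by simp [h, hm0.ne'] at hz'
    have h : Units.mk0 z hz0 ∈ H := by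
      rw [hH, mem_rootsOfUnity']
      exact hz'
    exact h

end Roots

/-! ### Operators on an order ideal -/

section Ideal

variable {A : Type*} [NormedRing A] [NormedAlgebra ℂ A] [PartialOrder A] [IsOrderedRing A]

/-- By axiom (A₄), an eigenvalue equation splits into its real and imaginary parts. -/
lemma isEigenpair_iff [PosSMulMono ℝ A] (hA4 : AxiomA4 A) {S : A →ₗ[ℂ] A}
    (hS : ∀ y, 0 ≤ y → 0 ≤ S y) {ζ : ℂ} {f g : A} (hf : f ∈ regularElements A)
    (hg : g ∈ regularElements A) :
    IsEigenpair (S.restrictScalars ℝ) ζ f g ↔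
      S (f + Complex.I • g) = ζ • (f + Complex.I • g) := by
  rw [smul_add_I_smul, map_add, map_smul]
  refine ⟨fun h => by rw [← h.1, ← h.2]; rfl, fun h => ?_⟩
  rw [← sub_eq_zero, add_sub_add_comm, ← smul_sub] at h
  obtain ⟨h1, h2⟩ := hA4 _
    (sub_mem_regularElements (map_mem_regularElements hS hf)
      (sub_mem_regularElements (smul_mem_regularElements _ hf) (smul_mem_regularElements _ hg))) _
    (sub_mem_regularElements (map_mem_regularElements hS hg)
      (add_mem_regularElements (smul_mem_regularElements _ hf) (smul_mem_regularElements _ hg))) h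
  exact ⟨sub_eq_zero.1 h1, sub_eq_zero.1 h2⟩

lemma mem_regularElements_of_mem_orderIdeal [PosSMulMono ℝ A] {b y : A} (hb : 0 ≤ b)
    (hy : y ∈ orderIdeal b) : y ∈ regularElements A := by
  obtain ⟨t, ht, h1, h2⟩ := hy
  exact ⟨t • b, t • b - y, smul_nonneg ht hb, sub_nonneg.2 h2, by rw [sub_sub_cancel]⟩

lemma mem_orderIdeal_of_mem_Icc [PosSMulMono ℝ A] {b y : A} (hy : y ∈ Icc (-b) b) :
    y ∈ orderIdeal b := ⟨1, zero_le_one, by simpa using hy.1, by simpa using hy.2⟩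

lemma map_mem_orderIdeal [PosSMulMono ℝ A] {S : A →ₗ[ℂ] A} (hS : ∀ y, 0 ≤ y → 0 ≤ S y) {b : A}
    (hSb : S b = b) (y : A) (hy : y ∈ orderIdeal b) : S.restrictScalars ℝ y ∈ orderIdeal b := by
  obtain ⟨t, ht, h1, h2⟩ := hy
  have htb : S (t • b) = t • b := by rw [← Complex.coe_smul, map_smul, hSb]
  refine ⟨t, ht, ?_, ?_⟩
  · have h := hS _ (sub_nonneg.2 h1)
    rwa [map_sub, map_neg, htb, sub_nonneg] at h
  · have h := hS _ (sub_nonneg.2 h2)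
    rwa [map_sub, htb, sub_nonneg] at h

/-- The operator on `C(K)` that corresponds to an operator `S` leaving `A_b` invariant. -/
noncomputable def transport [PosSMulMono ℝ A] {b : A} {K : Type*} [TopologicalSpace K]
    (e : orderIdeal b ≃ₗ[ℝ] C(K, ℝ)) (S : A →ₗ[ℝ] A) (hS : ∀ y ∈ orderIdeal b, S y ∈ orderIdeal b) :
    C(K, ℝ) →ₗ[ℝ] C(K, ℝ) :=
  e.toLinearMap ∘ₗ S.restrict hS ∘ₗ e.symm.toLinearMap

section Transport

variable [PosSMulMono ℝ A] {b : A} {K : Type*} [TopologicalSpace K]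
  {e : orderIdeal b ≃ₗ[ℝ] C(K, ℝ)}

lemma coe_symm_transport (S : A →ₗ[ℝ] A) (hS : ∀ y ∈ orderIdeal b, S y ∈ orderIdeal b)
    (f : C(K, ℝ)) : (e.symm (transport e S hS f) : A) = S (e.symm f) := by
  simp [transport]

lemma isEigenpair_transport_iff {S : A →ₗ[ℝ] A} {hS : ∀ y ∈ orderIdeal b, S y ∈ orderIdeal b}
    {ζ : ℂ} {f g : C(K, ℝ)} :
    IsEigenpair (transport e S hS) ζ f g ↔ IsEigenpair S ζ (e.symm f : A) (e.symm g : A) := by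
  unfold IsEigenpair
  rw [← e.symm.injective.eq_iff, ← e.symm.injective.eq_iff (a := transport e S hS g),
    ← Subtype.coe_injective.eq_iff, ← Subtype.coe_injective.eq_iff, coe_symm_transport,
    coe_symm_transport]
  simp

lemma symm_le_symm_iff (he : ∀ x y : orderIdeal b, e x ≤ e y ↔ (x : A) ≤ (y : A)) (f g : C(K, ℝ)) :
    (e.symm f : A) ≤ e.symm g ↔ f ≤ g := by
  rw [← he, e.apply_symm_apply, e.apply_symm_apply]

lemma transport_nonneg (he : ∀ x y : orderIdeal b, e x ≤ e y ↔ (x : A) ≤ (y : A)) {S : A →ₗ[ℝ] A}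
    {hS : ∀ y ∈ orderIdeal b, S y ∈ orderIdeal b} (hpos : ∀ y, 0 ≤ y → 0 ≤ S y) (f : C(K, ℝ))
    (hf : 0 ≤ f) : 0 ≤ transport e S hS f := by
  rw [← symm_le_symm_iff he, map_zero, ZeroMemClass.coe_zero] at hf ⊢
  rw [coe_symm_transport]
  exact hpos _ hf

end Transport

lemma eq_smul_of_minimal [PosSMulMono ℝ A] (hA4 : AxiomA4 A) {b m : A} (hb0 : 0 ≤ b)
    (hb : IsMinimalIdempotent b) (hm : m ∈ regularElements A) (hbm : b * m = m)
    (hmb : m * b = m) : ∃ c : ℝ, m = c • b := by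
  obtain ⟨μ, hμ⟩ : m ∈ range fun μ : ℂ => μ • b := by
    rw [← hb.2.2]
    exact ⟨m, by simp only [hbm, hmb]⟩
  have hbr : b ∈ regularElements A :=
    mem_regularElements_of_mem_orderIdeal hb0 (self_mem_orderIdeal hb0)
  refine ⟨μ.re, sub_eq_zero.1 (hA4 _ (sub_mem_regularElements hm (smul_mem_regularElements _ hbr))
    _ (smul_mem_regularElements (-μ.im) hbr) ?_).1⟩
  have hμ' : m = μ • b := hμ.symm
  rw [hμ', ← Complex.coe_smul, ← Complex.coe_smul, smul_smul, ← sub_smul, ← add_smul]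
  have : μ - (μ.re : ℂ) + Complex.I * ((-μ.im : ℝ) : ℂ) = 0 := by
    nth_rw 1 [← Complex.re_add_im μ]
    push_cast
    ring
  rw [this, zero_smul]

end Ideal

/-! ### The group structure of the peripheral spectrum -/

section Peripheral

variable {A : Type*} [NormedRing A] [NormedAlgebra ℂ A] [CompleteSpace A] [Nontrivial A]
    [PartialOrder A] [IsOrderedRing A] [PosSMulMono ℝ A] [OrderClosedTopology A]

/-- The unimodular `ζ` for which `r(a) ζ` is in the spectrum are closed under `ζ * conj η`: their
eigenvectors have constant modulus in `A_b = C(K)`, and so can be multiplied. -/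
lemma mul_star_mem_peripheral (hA1 : AxiomA1 A) (hA3 : AxiomA3 A) (hA4 : AxiomA4 A)
    (hA5 : AxiomA5 A) {a b : A} (ha : 0 ≤ a) (hr : 0 < specRadius a) (hbc : IsOrderContinuous b)
    (hb : IsAlgStrictlyPos b) (hmin : IsMinimalIdempotent b)
    (hab : a * b = specRadius a • b) (hba : b * a = specRadius a • b)
    (hlim : Tendsto (fun t : ℝ => (t - specRadius a) • resolvent a (t : ℂ)) (𝓝[>] specRadius a)
        (𝓝 b)) {ζ η : ℂ} (hζ : ‖ζ‖ = 1) (hη : ‖η‖ = 1)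
    (hζp : IsPole a ((specRadius a : ℂ) * ζ)) (hηp : IsPole a ((specRadius a : ℂ) * η)) :
    (specRadius a : ℂ) * (ζ * star η) ∈ spectrum ℂ a := by
  set r := specRadius a with hrdef
  have hb0 := hbc.nonneg
  have hrC : (r : ℂ) ≠ 0 := by exact_mod_cast hr.ne'
  obtain ⟨K, _, _, _, e, he, he1⟩ := hA3 b hb0 hmin.2.1
  have heb : (e.symm 1 : A) = b := by rw [← he1, e.symm_apply_apply]
  -- left and right multiplication by `a / r`
  let L : A →ₗ[ℂ] A := (r : ℂ)⁻¹ • LinearMap.mulLeft ℂ a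
  let R : A →ₗ[ℂ] A := (r : ℂ)⁻¹ • LinearMap.mulRight ℂ a
  have hL : ∀ y, L y = r⁻¹ • (a * y) := fun y => by
    rw [← Complex.coe_smul, Complex.ofReal_inv]
    rfl
  have hR : ∀ y, R y = r⁻¹ • (y * a) := fun y => by
    rw [← Complex.coe_smul, Complex.ofReal_inv]
    rfl
  have hLpos : ∀ y, 0 ≤ y → 0 ≤ L y := fun y hy => by
    rw [hL]
    exact smul_nonneg (by positivity) (mul_nonneg ha hy)
  have hRpos : ∀ y, 0 ≤ y → 0 ≤ R y := fun y hy => by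
    rw [hR]
    exact smul_nonneg (by positivity) (mul_nonneg hy ha)
  have hLb : L b = b := by rw [hL, hab, smul_smul, inv_mul_cancel₀ hr.ne', one_smul]
  have hRb : R b = b := by rw [hR, hba, smul_smul, inv_mul_cancel₀ hr.ne', one_smul]
  set TL := transport e (L.restrictScalars ℝ) (map_mem_orderIdeal hLpos hLb) with hTL
  set TR := transport e (R.restrictScalars ℝ) (map_mem_orderIdeal hRpos hRb) with hTR
  have hTLpos : ∀ f, 0 ≤ f → 0 ≤ TL f := transport_nonneg he hLpos
  have hTRpos : ∀ f, 0 ≤ f → 0 ≤ TR f := transport_nonneg he hRpos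
  have hTL1 : TL 1 = 1 := by
    refine e.symm.injective (Subtype.ext ?_)
    rw [hTL, coe_symm_transport, heb]
    exact hLb
  have key : ∀ {ξ : ℂ}, ‖ξ‖ = 1 → IsPole a ((r : ℂ) * ξ) →
      ∃ F G : C(K, ℝ), F * F + G * G = 1 ∧ IsEigenpair TL ξ F G := by
    intro ξ hξ hp
    obtain ⟨f, g, hf, hg, hne, hfgl, hfgr⟩ := exists_peripheral_eigenvector hA5 ha hlim hξ hp
    have hf' := mem_orderIdeal_of_mem_Icc hf
    have hg' := mem_orderIdeal_of_mem_Icc hg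
    set F := e ⟨f, hf'⟩ with hF
    set G := e ⟨g, hg'⟩ with hG
    have hFf : (e.symm F : A) = f := by rw [hF, e.symm_apply_apply]
    have hGg : (e.symm G : A) = g := by rw [hG, e.symm_apply_apply]
    have hEL : IsEigenpair TL ξ F G := by
      rw [hTL, isEigenpair_transport_iff, hFf, hGg, isEigenpair_iff hA4 hLpos
        (mem_regularElements_of_mem_Icc hb0 hf) (mem_regularElements_of_mem_Icc hb0 hg)]
      change (r : ℂ)⁻¹ • (a * (f + Complex.I • g)) = _
      rw [hfgl, smul_smul, inv_mul_cancel_left₀ hrC]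
    have hER : IsEigenpair TR ξ F G := by
      rw [hTR, isEigenpair_transport_iff, hFf, hGg, isEigenpair_iff hA4 hRpos
        (mem_regularElements_of_mem_Icc hb0 hf) (mem_regularElements_of_mem_Icc hb0 hg)]
      change (r : ℂ)⁻¹ • ((f + Complex.I • g) * a) = _
      rw [hfgr, smul_smul, inv_mul_cancel_left₀ hrC]
    -- the modulus is an eigenvector for `r`, hence a multiple of `b`
    let m : orderIdeal b := e.symm (modulus F G)
    have hm0 : 0 ≤ (m : A) := by
      have h : (0 : C(K, ℝ)) ≤ modulus F G := fun x => Real.sqrt_nonneg (F x * F x + G x * G x)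
      rwa [← symm_le_symm_iff he, map_zero, ZeroMemClass.coe_zero] at h
    have hmL : r • (m : A) ≤ a * m := by
      have h := hEL.modulus_le hTLpos hξ
      rw [← symm_le_symm_iff he, hTL, coe_symm_transport] at h
      have h' : (m : A) ≤ r⁻¹ • (a * m) := by rw [← hL]; exact h
      have h2 := smul_le_smul_of_nonneg_left h' hr.le
      rwa [smul_smul, mul_inv_cancel₀ hr.ne', one_smul] at h2
    have hmR : r • (m : A) ≤ m * a := by
      have h := hER.modulus_le hTRpos hξ
      rw [← symm_le_symm_iff he, hTR, coe_symm_transport] at h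
      have h' : (m : A) ≤ r⁻¹ • (m * a) := by rw [← hR]; exact h
      have h2 := smul_le_smul_of_nonneg_left h' hr.le
      rwa [smul_smul, mul_inv_cancel₀ hr.ne', one_smul] at h2
    obtain ⟨hbm, hmb⟩ := perron_mul_eq hlim
      (mul_eq_smul_of_le hA1 ha hr.le hbc hb hab hba m.2 hmL hm0)
      (mul_eq_smul_of_le' hA1 ha hr.le hbc hb hab hba m.2 hmR hm0)
    obtain ⟨c, hc⟩ := eq_smul_of_minimal hA4 hb0 hmin
      (mem_regularElements_of_mem_orderIdeal hb0 m.2) hbm hmb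
    have hmod : modulus F G = c • 1 := by
      refine e.symm.injective (Subtype.ext ?_)
      rw [map_smul, SetLike.val_smul, heb]
      exact hc
    have hsq : ∀ x, F x * F x + G x * G x = c * c := fun x => by
      have h : √(F x * F x + G x * G x) = c := by
        rw [← modulus_apply, hmod, ContinuousMap.smul_apply, ContinuousMap.one_apply, smul_eq_mul,
          mul_one]
      rw [← h, Real.mul_self_sqrt (add_nonneg (mul_self_nonneg _) (mul_self_nonneg _))]
    have hc0 : c ≠ 0 := by
      rintro rfl
      have h0 : ∀ x, F x = 0 ∧ G x = 0 := fun x => by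
        have := hsq x
        rw [mul_zero] at this
        exact mul_self_add_mul_self_eq_zero.1 this
      have hF0 : F = 0 := ContinuousMap.ext fun x => (h0 x).1
      have hG0 : G = 0 := ContinuousMap.ext fun x => (h0 x).2
      refine hne ?_
      rw [← hFf, ← hGg, hF0, hG0]
      simp
    refine ⟨c⁻¹ • F, c⁻¹ • G, ?_, ?_, ?_⟩
    · ext x
      simp only [ContinuousMap.add_apply, ContinuousMap.mul_apply, ContinuousMap.smul_apply,
        ContinuousMap.one_apply, smul_eq_mul]
      have := hsq x
      field_simp
      linarith
    · rw [map_smul, hEL.1, smul_sub, smul_comm c⁻¹, smul_comm c⁻¹]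
    · rw [map_smul, hEL.2, smul_add, smul_comm c⁻¹, smul_comm c⁻¹]
  obtain ⟨F, G, hFG, hE⟩ := key hζ hζp
  obtain ⟨F', G', hFG', hE'⟩ := key hη hηp
  have hprod := hE.mul_conj hTLpos hTL1 hζ hFG hE'
  set U := F * F' + G * G' with hU
  set V := G * F' - F * G' with hV
  have hUV : U * U + V * V = 1 := by
    calc U * U + V * V = (F * F + G * G) * (F' * F' + G' * G') := by rw [hU, hV]; ring
      _ = 1 := by rw [hFG, hFG', one_mul]
  have hUr := mem_regularElements_of_mem_orderIdeal hb0 (e.symm U).2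
  have hVr := mem_regularElements_of_mem_orderIdeal hb0 (e.symm V).2
  rw [hTL, isEigenpair_transport_iff, isEigenpair_iff hA4 hLpos hUr hVr] at hprod
  refine mem_spectrum_of_mul_eq_smul (x := (e.symm U : A) + Complex.I • (e.symm V : A)) ?_ ?_
  · intro h
    obtain ⟨h1, h2⟩ := hA4 _ hUr _ hVr h
    have hU0 : U = 0 := by simpa using h1
    have hV0 : V = 0 := by simpa using h2
    rw [hU0, hV0] at hUV
    have h01 : (e.symm 1 : A) = 0 := by rw [← hUV]; simp
    exact hmin.2.1 (heb.symm.trans h01)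
  · change (r : ℂ)⁻¹ • (a * _) = _ at hprod
    rw [mul_smul, ← hprod, smul_smul, mul_inv_cancel₀ hrC, one_smul]

end Peripheral

end OrdBanachAlg

theorem theorem20 {A : Type*} [NormedRing A] [NormedAlgebra ℂ A] [CompleteSpace A] [Nontrivial A]
    [PartialOrder A] [IsOrderedRing A] [PosSMulMono ℝ A] [OrderClosedTopology A]
    (hA1 : OrdBanachAlg.AxiomA1 A) (hA2 : OrdBanachAlg.AxiomA2 A) (hA3 : OrdBanachAlg.AxiomA3 A)
    (hA4 : OrdBanachAlg.AxiomA4 A) (hA5 : OrdBanachAlg.AxiomA5 A) (hLS : OrdBanachAlg.AxiomLS' A)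
    (a : A) (ha0 : a ≠ 0) (hac : OrdBanachAlg.IsOrderContinuous a)
    (hai : OrdBanachAlg.IsIrreducible a)
    (hap : OrdBanachAlg.IsPole a (OrdBanachAlg.specRadius a : ℂ)) :
    (∀ z ∈ OrdBanachAlg.peripheralSpectrum a, OrdBanachAlg.IsPole a z) ∧
      ∃ m : ℕ, 1 ≤ m ∧ OrdBanachAlg.peripheralSpectrum a =
        (fun ζ : ℂ => (OrdBanachAlg.specRadius a : ℂ) * ζ) '' OrdBanachAlg.rootsOfUnitySet m := by
  open OrdBanachAlg in
  have hmem : (specRadius a : ℂ) ∈ spectrum ℂ a := by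
    obtain ⟨k, -, hiso, -⟩ := hap
    exact hiso.1
  rcases (specRadius_nonneg a).eq_or_lt with hr | hr
  · -- for `r(a) = 0` the peripheral spectrum is `{0}`
    have hper : peripheralSpectrum a = {0} := by
      ext z
      refine ⟨fun hz => norm_eq_zero.1 (hz.2.trans hr.symm), ?_⟩
      rintro rfl
      rw [← hr, Complex.ofReal_zero] at hmem
      exact ⟨hmem, by rw [norm_zero, hr]⟩
    rw [hper, ← hr]
    rw [← hr] at hap
    refine ⟨fun z hz => ?_, 1, le_rfl, ?_⟩
    · rw [mem_singleton_iff.1 hz]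
      exact_mod_cast hap
    · simp [rootsOfUnitySet]
  · obtain ⟨b, hbc, hbpos, hbb, hab, hba, hres, hlim⟩ :=
      exists_perron_projection hA1 ha0 hac hai hap hr
    have hpoles := hLS a hac.nonneg hap b hres hbc hbpos
    refine ⟨hpoles, ?_⟩
    have hmin := hA2 b hbb hbpos
    have hrC : (specRadius a : ℂ) ≠ 0 := by exact_mod_cast hr.ne'
    set S : Set ℂ := {ζ | (specRadius a : ℂ) * ζ ∈ peripheralSpectrum a} with hS
    have hinj : Function.Injective fun ζ : ℂ => (specRadius a : ℂ) * ζ :=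
      mul_right_injective₀ hrC
    have himage : peripheralSpectrum a = (fun ζ : ℂ => (specRadius a : ℂ) * ζ) '' S := by
      rw [hS]
      refine (image_preimage_eq _ fun z => ⟨(specRadius a : ℂ)⁻¹ * z, ?_⟩).symm
      exact mul_inv_cancel_left₀ hrC z
    have hnorm_iff : ∀ ζ : ℂ, ‖(specRadius a : ℂ) * ζ‖ = specRadius a ↔ ‖ζ‖ = 1 := fun ζ => by
      rw [norm_mul, Complex.norm_of_nonneg hr.le, mul_eq_left₀ hr.ne']
    have hnorm : ∀ ζ ∈ S, ‖ζ‖ = 1 := fun ζ hζ => (hnorm_iff ζ).1 hζ.2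
    obtain ⟨m, hm, hSm⟩ := exists_eq_rootsOfUnitySet (S := S)
      ((finite_peripheralSpectrum hpoles).preimage hinj.injOn)
      ⟨1, by rw [mul_one]; exact hmem, (hnorm_iff 1).2 norm_one⟩ hnorm fun ζ hζ η hη => by
        refine ⟨mul_star_mem_peripheral hA1 hA3 hA4 hA5 hac.nonneg hr hbc hbpos hmin hab hba hlim
          (hnorm ζ hζ) (hnorm η hη) (hpoles _ hζ) (hpoles _ hη), (hnorm_iff _).2 ?_⟩
        rw [norm_mul, norm_star, hnorm ζ hζ, hnorm η hη, one_mul]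
    exact ⟨m, hm, by rw [himage, hSm]⟩
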